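/- Let $1<p<\infty$ and let $Q_0\subset\mathbb R$ be a bounded interval with endpoints $a<b$ (each endpoint may or may not belong to $Q_0$). For an integrable $f:Q_0\to\mathbb R$ and a countable collection $\mathcal J$ of pairwise disjoint nondegenerate intervals $J\subset Q_0$ put $$S_p(f,\mathcal J)=\sum_{J\in\mathcal J}|J|\Big(\frac1{|J|}\int_J|f-f_J|\Big)^p,\qquad f_J=\frac1{|J|}\int_J f .$$ We say $f\in JN_p(Q_0)$ if $f\in L^1(Q_0)$ and there is $K<\infty$ with $S_p(f,\mathcal J)\le K^p$ for all such $\mathcal J$. We say $f\in VJN_p(Q_0)$ if $f\in JN_p(Q_0)$ and $$\lim_{\alpha\to0^+}\ \sup\{S_p(f,\mathcal J):\ \mathcal J\text{ as above with } |J|\le\alpha\text{ for all }J\in\mathcal J\}=0 .$$ For integers $i\ge1$ let $$l_i=2^{-(i+1/2)^2},\qquad d_i=2^{-(i+1)^2},\qquad h_i=\Big(\frac{2^{i^2}}{i}\Big)^{1/p}.$$ To every dyadic interval $I\subseteq[0,\tfrac12)$ of length $2^{-i}$, $i\ge1$, assign a closed interval $\hat I$ of length $l_i$ recursively: for $I=[0,\tfrac12)$,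 $\hat I$ is the interval of length $l_1$ centred at $\tfrac12$; if $\hat I$ has been defined for $I$ of length $2^{-i}$ and $I'$ is the left (right) half of $I$, then $\hat I'$ is the interval of length $l_{i+1}$ to the left (right) of $\hat I$ with $\operatorname{dist}(\hat I',\hat I)=d_i$. Let $$G(x)=\sum_{i\ge1}\ \sum_{\substack{I\subseteq[0,1/2)\text{ dyadic}\\ |I|=2^{-i}}}h_i\,\mathbf 1_{\hat I}(x),\qquad g_0(x)=G\Big(\frac{x-a}{b-a}\Big)\quad(x\in Q_0).$$ Then $g_0\in VJN_p(Q_0)$ and $g_0\notin L^p(Q_0)$. Moreover $L^p(Q_0)\subsetneq VJN_p(Q_0)$. -/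

import Mathlib

open MeasureTheory Set Filter Topology

namespace JohnNirenberg

/-! ### The spaces `JN_p` and `VJN_p` on an interval

Functions on an interval `Q` are represented by functions `ℝ → ℝ`; all notions below depend only
on the values in `Q`. In dimension one the cubes are the nondegenerate bounded intervals (open,
closed or half-open), and the side length of a cube is the length of the interval. -/

/-- `𝒥` is a countable collection of pairwise disjoint nondegenerate intervals contained in `Q`. -/
structure IsDisjointIntervalFamily (Q : Set ℝ) (𝒥 : Set (Set ℝ)) : Prop where
  countable : 𝒥.Countable
  disjoint : 𝒥.PairwiseDisjoint id
  interval : ∀ J ∈ 𝒥, J.OrdConnected ∧ J.Nontrivial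
  subset : ∀ J ∈ 𝒥, J ⊆ Q

/-- `|J| (⨍_J |f - f_J|) ^ p`, where `f_J = ⨍_J f`. -/
noncomputable def oscTerm (p : ℝ) (f : ℝ → ℝ) (J : Set ℝ) : ℝ :=
  volume.real J * (⨍ x in J, |f x - ⨍ y in J, f y|) ^ p

/-- `∑_{J ∈ 𝒥} |J| (⨍_J |f - f_J|) ^ p`, as an extended nonnegative number. -/
noncomputable def oscSum (p : ℝ) (f : ℝ → ℝ) (𝒥 : Set (Set ℝ)) : ENNReal :=
  ∑' J : 𝒥, ENNReal.ofReal (oscTerm p f J)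

/-- `f ∈ JN_p(Q)`. -/
def MemJN (p : ℝ) (Q : Set ℝ) (f : ℝ → ℝ) : Prop :=
  IntegrableOn f Q volume ∧
    ∃ K : ℝ, 0 ≤ K ∧ ∀ 𝒥 : Set (Set ℝ), IsDisjointIntervalFamily Q 𝒥 →
      oscSum p f 𝒥 ≤ ENNReal.ofReal (K ^ p)

/-- The supremum of `∑_{J ∈ 𝒥} |J| (⨍_J |f - f_J|) ^ p` over all countable collections `𝒥` of
pairwise disjoint intervals in `Q` of length at most `a`. -/
noncomputable def oscModulus (p : ℝ) (Q : Set ℝ) (f : ℝ → ℝ) (a : ℝ) : ENNReal :=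
  ⨆ (𝒥 : Set (Set ℝ)) (_ : IsDisjointIntervalFamily Q 𝒥) (_ : ∀ J ∈ 𝒥, volume.real J ≤ a),
    oscSum p f 𝒥

/-- `f ∈ VJN_p(Q)`. -/
def MemVJN (p : ℝ) (Q : Set ℝ) (f : ℝ → ℝ) : Prop :=
  MemJN p Q f ∧ Tendsto (fun a : ℝ => oscModulus p Q f a) (𝓝[>] 0) (𝓝 0)

/-! ### The tower function

The dyadic subintervals of `[0, 1/2)` of length `2 ^ (-i)`, `i ≥ 1`, are
`[k 2 ^ (-i), (k + 1) 2 ^ (-i))` with `k < 2 ^ (i - 1)`; such an interval `I` is represented by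
the pair `(i, k)`. Its left half is `(i + 1, 2 k)` and its right half is `(i + 1, 2 k + 1)`. -/

/-- The width `l_i = 2 ^ (-(i + 1/2)²)` of the towers of generation `i`. -/
noncomputable def towerWidth (i : ℕ) : ℝ := (2 : ℝ) ^ (-((i : ℝ) + 1 / 2) ^ 2)

/-- The distance `d_i = 2 ^ (-(i + 1)²)` of a tower of generation `i` to its two children. -/
noncomputable def towerDist (i : ℕ) : ℝ := (2 : ℝ) ^ (-((i : ℝ) + 1) ^ 2)

/-- The height `h_i = (2 ^ (i²) / i) ^ (1 / p)` of the towers of generation `i`. -/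
noncomputable def towerHeight (p : ℝ) (i : ℕ) : ℝ := ((2 : ℝ) ^ (i ^ 2) / (i : ℝ)) ^ (1 / p)

/-- The left endpoint of the tower attached to the dyadic interval `(i, k)`, for `i ≥ 1` (the value
at `i = 0` is not used). The tower of generation `1` is centred in `[0, 1]`; the tower attached to
the left (right) half of `(i, k)` lies to the left (right) of the tower attached to `(i, k)`, at
distance `d_i`. -/
noncomputable def towerLeft : ℕ → ℕ → ℝ
  | 0, _ => 0
  | 1, _ => 1 / 2 - towerWidth 1 / 2
  | i + 2, k =>
      if Even k then towerLeft (i + 1) (k / 2) - towerDist (i + 1) - towerWidth (i + 2)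
      else towerLeft (i + 1) (k / 2) + towerWidth (i + 1) + towerDist (i + 1)

/-- The base of the tower attached to the dyadic interval `(i, k)`. -/
noncomputable def towerBase (i k : ℕ) : Set ℝ :=
  Icc (towerLeft i k) (towerLeft i k + towerWidth i)

/-- The tower function on `[0, 1]`: the sum, over the generations `i = n + 1 ≥ 1` and the `2 ^ n`
towers of that generation, of `h_i` times the indicator function of the base of the tower. -/
noncomputable def unitTowerFun (p : ℝ) (x : ℝ) : ℝ :=
  ∑' n : ℕ, ∑ k ∈ Finset.range (2 ^ n),
    (towerBase (n + 1) k).indicator (fun _ => towerHeight p (n + 1)) x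

/-- The tower function on an interval with endpoints `a < b`, obtained from the one on `[0, 1]` by
the affine change of variable. -/
noncomputable def towerFun (p a b : ℝ) (x : ℝ) : ℝ := unitTowerFun p ((x - a) / (b - a))

end JohnNirenberg

/-!
Call a measure `μ` a majorant of `f` on a class of intervals if `oscTerm p f J ≤ μ J` for each `J`
in the class. Summing over disjoint intervals then costs at most the total mass of `μ`, whatever
the family. So `f ∈ L^1` lies in `VJN_p` as soon as, for every `ε`, it has a majorant of mass at
most `ε` on all sufficiently short intervals (`memVJN_of_majorant`).

For `f ∈ L^p` and `g` continuous with compact support near `f` in `L^p`, Jensen's inequality gives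
the majorant with density `2 ^ p * (|f - g| + η) ^ p`, where `η` bounds the oscillation of `g` on
short intervals (`exists_majorant_of_memLp`). Hence `L^p ⊆ VJN_p`.

The towers form a binary search tree: a tower separates its left descendants from its right ones.
Therefore an interval `J` that meets towers meets a single tower `T` of smallest generation, and
all others that it meets descend from `T` (`exists_top_tower`). Let `i` be the generation of `T`,
with width `l`, distance `d` and height `h`. If `J ⊆ T`, there is no oscillation. Otherwise `J`
contains an endpoint of `T`, and up to constants its oscillation term is bounded by the sum of
`h ^ p * min |J ∩ T| |J \ T|` and of a contribution of the descendants. The latter vanishes unless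
`J` crosses a gap of length about `d`, which makes it at most a multiple of `2 ^ (-p i)`. As for the
former, if `J` does not reach beyond the descendants of `T`, then `|J \ T| ≤ 4 d`, and `h ^ p * d`
is at most `4 ^ (-i) / i`. These bounds are summable over all towers. If `J` does reach beyond them,
only the bound `h ^ p * l`, about `2 ^ (-i) / i`, is left, whose sum over all towers diverges; this
is why `g₀ ∉ L^p` (`not_memLp_towerFun`). But then `J` swallows a whole subtree hanging from `T`.
Putting mass about `2 ^ (-j) / j ^ 2` on the endpoints of each tower of generation `j`, the total
mass is finite, and that subtree carries mass about `∑ j > i, 2 ^ (-i) / j ^ 2`, which is about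
`2 ^ (-i) / i`. So this atomic measure, `endpointMeasure`, is up to a constant a majorant
(`ofReal_oscTerm_unitTowerFun_le`). Its part on the generations beyond `N` has small mass and takes
care of the short intervals that meet those generations. Elsewhere the tower function is bounded,
and the result on `L^p` applies (`memVJN_towerFun`).
-/

namespace JohnNirenberg

/-! ### Mean oscillation and majorising measures -/

theorem volume_pos_of_ordConnected {J : Set ℝ} (hJ : J.OrdConnected) (hn : J.Nontrivial) :
    0 < volume J := by
  obtain ⟨x, hx, y, hy, hxy⟩ := hn.exists_lt
  refine lt_of_lt_of_le ?_ (measure_mono (hJ.out hx hy))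
  simp [hxy]

theorem integral_abs_sub_integral_le {α : Type*} [MeasurableSpace α] {P : Measure α}
    [IsProbabilityMeasure P] {f : α → ℝ} (hf : Integrable f P) (c : ℝ) :
    ∫ x, |f x - ∫ y, f y ∂P| ∂P ≤ 2 * ∫ x, |f x - c| ∂P := by
  have hc : Integrable (fun x => f x - c) P := hf.sub (integrable_const c)
  have h1 : |c - ∫ y, f y ∂P| ≤ ∫ x, |f x - c| ∂P := by
    have : ∫ x, (f x - c) ∂P = (∫ y, f y ∂P) - c := by
      rw [integral_sub hf (integrable_const c)]; simp
    rw [abs_sub_comm, ← this]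
    exact abs_integral_le_integral_abs
  calc ∫ x, |f x - ∫ y, f y ∂P| ∂P
      ≤ ∫ x, (|f x - c| + |c - ∫ y, f y ∂P|) ∂P := by
        refine integral_mono (hf.sub (integrable_const _)).abs
          (hc.abs.add (integrable_const _)) fun x => abs_sub_le _ _ _
    _ = ∫ x, |f x - c| ∂P + |c - ∫ y, f y ∂P| := by
        rw [integral_add hc.abs (integrable_const _)]; simp
    _ ≤ 2 * ∫ x, |f x - c| ∂P := by linarith

/-- The mean `f_J` may be replaced by any constant, at the price of a factor `2 ^ p`. -/
theorem oscTerm_le {p : ℝ} (hp : 0 ≤ p) {f : ℝ → ℝ} {J : Set ℝ} (hf : IntegrableOn f J)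
    (h0 : volume J ≠ 0) (h1 : volume J ≠ ⊤) (c : ℝ) :
    oscTerm p f J ≤ volume.real J * (2 * ⨍ x in J, |f x - c|) ^ p := by
  have : IsProbabilityMeasure
      (((volume.restrict J) univ)⁻¹ • volume.restrict J : Measure ℝ) := by
    constructor
    simp [ENNReal.inv_mul_cancel h0 h1]
  have hf' : Integrable f (((volume.restrict J) univ)⁻¹ • volume.restrict J) := by
    refine Integrable.smul_measure hf ?_
    simpa using h0
  unfold oscTerm
  refine mul_le_mul_of_nonneg_left (Real.rpow_le_rpow ?_ ?_ hp) measureReal_nonneg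
  · exact integral_nonneg fun x => abs_nonneg _
  · exact integral_abs_sub_integral_le hf' c

theorem oscTerm_congr {p : ℝ} {f g : ℝ → ℝ} {J : Set ℝ} (hJ : MeasurableSet J)
    (h : EqOn f g J) : oscTerm p f J = oscTerm p g J := by
  have h1 : ⨍ y in J, f y = ⨍ y in J, g y := by
    rw [setAverage_eq, setAverage_eq, setIntegral_congr_fun hJ h]
  unfold oscTerm
  rw [h1]
  congr 2
  generalize ⨍ y in J, g y = c
  rw [setAverage_eq, setAverage_eq]
  congr 1
  exact setIntegral_congr_fun hJ fun x hx => by simp only [h hx]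

theorem oscSum_le_measure_univ {p : ℝ} {f : ℝ → ℝ} {Q : Set ℝ} {𝒥 : Set (Set ℝ)}
    (h𝒥 : IsDisjointIntervalFamily Q 𝒥) {μ : Measure ℝ}
    (h : ∀ J ∈ 𝒥, ENNReal.ofReal (oscTerm p f J) ≤ μ J) : oscSum p f 𝒥 ≤ μ univ := by
  have h1 : oscSum p f 𝒥 ≤ ∑' J : 𝒥, μ J := ENNReal.tsum_le_tsum fun J => h J J.2
  have h2 : μ (⋃ J ∈ 𝒥, id J) = ∑' J : 𝒥, μ (id (J : Set ℝ)) :=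
    measure_biUnion h𝒥.countable h𝒥.disjoint fun J hJ => (h𝒥.interval J hJ).1.measurableSet
  exact h1.trans (h2.symm.le.trans (measure_mono (subset_univ _)))

/-- On a set of finite measure, an integrable function belongs to `VJN_p` as soon as, on short
intervals, its oscillation terms are majorised by measures of arbitrarily small total mass:
summing a majorising measure over a disjoint family costs at most its total mass. On long
intervals a multiple of Lebesgue measure is a majorant, so that membership in `JN_p` comes for
free. -/
theorem memVJN_of_majorant {p : ℝ} (hp : 1 < p) {Q : Set ℝ} (hQ : volume Q ≠ ⊤) {f : ℝ → ℝ}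
    (hf : IntegrableOn f Q)
    (h : ∀ ε : ENNReal, 0 < ε → ∃ δ : ℝ, 0 < δ ∧ ∃ μ : Measure ℝ, μ univ ≤ ε ∧
      ∀ J ⊆ Q, J.OrdConnected → J.Nontrivial → volume.real J ≤ δ →
        ENNReal.ofReal (oscTerm p f J) ≤ μ J) : MemVJN p Q f := by
  refine ⟨⟨hf, ?_⟩, ?_⟩
  · obtain ⟨δ, hδ, μ, hμ, hμJ⟩ := h 1 one_pos
    set C : ℝ := (2 * (δ⁻¹ * ∫ x in Q, |f x|)) ^ p with hC
    have hI : 0 ≤ ∫ x in Q, |f x| := integral_nonneg fun x => abs_nonneg _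
    have hC0 : 0 ≤ C := by positivity
    set ν : Measure ℝ := μ + ENNReal.ofReal C • volume.restrict Q with hν
    have hνfin : ν univ ≠ ⊤ := by
      have : ν univ = μ univ + ENNReal.ofReal C * volume Q := by simp [hν]
      rw [this]
      exact ENNReal.add_ne_top.2 ⟨(hμ.trans_lt ENNReal.one_lt_top).ne,
        ENNReal.mul_ne_top ENNReal.ofReal_ne_top hQ⟩
    refine ⟨(ν univ).toReal ^ (1 / p), by positivity, fun 𝒥 h𝒥 => ?_⟩
    rw [← Real.rpow_mul ENNReal.toReal_nonneg, one_div_mul_cancel (by linarith), Real.rpow_one,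
      ENNReal.ofReal_toReal hνfin]
    refine oscSum_le_measure_univ h𝒥 fun J hJ => ?_
    obtain ⟨hJo, hJn⟩ := h𝒥.interval J hJ
    have hJQ := h𝒥.subset J hJ
    have hJfin : volume J ≠ ⊤ := ne_top_of_le_ne_top hQ (measure_mono hJQ)
    have hνJ : ν J = μ J + ENNReal.ofReal C * volume J := by
      simp [hν, Measure.restrict_apply hJo.measurableSet, inter_eq_left.2 hJQ]
    rw [hνJ]
    rcases le_or_gt (volume.real J) δ with hle | hlt
    · exact (hμJ J hJQ hJo hJn hle).trans le_self_add
    · refine le_trans ?_ le_add_self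
      have hb : oscTerm p f J ≤ C * volume.real J := by
        refine (oscTerm_le (by linarith) (hf.mono_set hJQ)
          (volume_pos_of_ordConnected hJo hJn).ne' hJfin 0).trans ?_
        rw [mul_comm]
        refine mul_le_mul_of_nonneg_right ?_ measureReal_nonneg
        have h0 : 0 ≤ ∫ x in J, |f x| := integral_nonneg fun x => abs_nonneg _
        simp only [sub_zero, setAverage_eq, smul_eq_mul]
        refine Real.rpow_le_rpow (by positivity) ?_ (by linarith)
        refine mul_le_mul_of_nonneg_left ?_ (by norm_num)
        refine mul_le_mul (inv_anti₀ hδ hlt.le) ?_ h0 (by positivity)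
        exact setIntegral_mono_set hf.abs (ae_of_all _ fun x => abs_nonneg _)
          (ae_of_all _ hJQ)
      refine (ENNReal.ofReal_le_ofReal hb).trans ?_
      rw [ENNReal.ofReal_mul hC0, measureReal_def, ENNReal.ofReal_toReal hJfin]
  · rw [ENNReal.tendsto_nhds_zero]
    intro ε hε
    obtain ⟨δ, hδ, μ, hμ, hμJ⟩ := h ε hε
    filter_upwards [Ioo_mem_nhdsGT hδ] with a ha
    refine iSup_le fun 𝒥 => iSup_le fun h𝒥 => iSup_le fun hle => ?_
    refine (oscSum_le_measure_univ h𝒥 fun J hJ => ?_).trans hμ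
    exact hμJ J (h𝒥.subset J hJ) (h𝒥.interval J hJ).1 (h𝒥.interval J hJ).2
      ((hle J hJ).trans ha.2.le)

/-! ### The tree of towers -/

theorem towerWidth_pos (i : ℕ) : 0 < towerWidth i := Real.rpow_pos_of_pos two_pos _

theorem towerDist_pos (i : ℕ) : 0 < towerDist i := Real.rpow_pos_of_pos two_pos _

theorem four_mul_towerDist_succ_le (i : ℕ) : 4 * towerDist (i + 1) ≤ towerDist i := by
  have h : (4 : ℝ) = 2 ^ (2 : ℝ) := by norm_num
  unfold towerDist
  rw [h, ← Real.rpow_add two_pos]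
  refine Real.rpow_le_rpow_of_exponent_le one_le_two ?_
  push_cast
  nlinarith [(Nat.cast_nonneg i : (0 : ℝ) ≤ i)]

theorem two_mul_towerWidth_succ_le (i : ℕ) : 2 * towerWidth (i + 1) ≤ towerDist i := by
  have h : (2 : ℝ) * towerWidth (i + 1) = 2 ^ (1 : ℝ) * towerWidth (i + 1) := by norm_num
  unfold towerDist
  rw [h, towerWidth, ← Real.rpow_add two_pos]
  refine Real.rpow_le_rpow_of_exponent_le one_le_two ?_
  push_cast
  nlinarith [(Nat.cast_nonneg i : (0 : ℝ) ≤ i)]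

theorem towerDist_anti {i j : ℕ} (h : i ≤ j) : towerDist j ≤ towerDist i := by
  refine antitone_nat_of_succ_le (fun n => ?_) h
  linarith [four_mul_towerDist_succ_le n, towerDist_pos (n + 1)]

/-- The closed `2 d_i`-neighbourhood of the tower `(i, k)`; it contains all its descendants. -/
noncomputable def towerHull (i k : ℕ) : Set ℝ :=
  Icc (towerLeft i k - 2 * towerDist i) (towerLeft i k + towerWidth i + 2 * towerDist i)

theorem towerBase_subset_towerHull (i k : ℕ) : towerBase i k ⊆ towerHull i k := by
  have := towerDist_pos i
  exact Icc_subset_Icc (by linarith) (by linarith)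

theorem towerHull_left {i k : ℕ} (hk : Even k) : towerHull (i + 2) k ⊆
    Icc (towerLeft (i + 1) (k / 2) - 2 * towerDist (i + 1))
      (towerLeft (i + 1) (k / 2) - towerDist (i + 1) / 2) := by
  have h1 := four_mul_towerDist_succ_le (i + 1)
  have h2 := two_mul_towerWidth_succ_le (i + 1)
  rw [towerHull, towerLeft, if_pos hk]
  exact Icc_subset_Icc (by linarith) (by linarith)

theorem towerHull_right {i k : ℕ} (hk : ¬ Even k) : towerHull (i + 2) k ⊆
    Icc (towerLeft (i + 1) (k / 2) + towerWidth (i + 1) + towerDist (i + 1) / 2)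
      (towerLeft (i + 1) (k / 2) + towerWidth (i + 1) + 2 * towerDist (i + 1)) := by
  have h1 := four_mul_towerDist_succ_le (i + 1)
  have h2 := two_mul_towerWidth_succ_le (i + 1)
  rw [towerHull, towerLeft, if_neg hk]
  exact Icc_subset_Icc (by linarith) (by linarith)

theorem towerHull_succ_subset (n k : ℕ) : towerHull (n + 2) k ⊆ towerHull (n + 1) (k / 2) := by
  have h1 := towerDist_pos (n + 1)
  have h2 := towerWidth_pos (n + 1)
  by_cases hk : Even k
  · exact (towerHull_left hk).trans (Icc_subset_Icc le_rfl (by linarith))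
  · exact (towerHull_right hk).trans (Icc_subset_Icc (by linarith) le_rfl)

theorem towerHull_add_subset (n m k : ℕ) :
    towerHull (n + m + 1) k ⊆ towerHull (n + 1) (k / 2 ^ m) := by
  induction m generalizing k with
  | zero => simp
  | succ m ih =>
    refine (towerHull_succ_subset (n + m) k).trans ((ih (k / 2)).trans ?_)
    rw [Nat.div_div_eq_div_mul, pow_succ']

/-- The towers of generation `n + 1` and more that an interval meets all descend from one tower
of generation `n + 1`, if the interval meets no tower of a smaller generation: a smallest common
ancestor of two towers separates them. -/
theorem exists_common_ancestor {J : Set ℝ} (hJ : J.OrdConnected) (n : ℕ)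
    (h : ∀ m < n, ∀ k < 2 ^ m, ¬ (J ∩ towerBase (m + 1) k).Nonempty) :
    ∃ a < 2 ^ n, ∀ m k, k < 2 ^ (n + m) → (J ∩ towerBase (n + m + 1) k).Nonempty →
      k / 2 ^ m = a := by
  induction n with
  | zero =>
    refine ⟨0, by simp, fun m k hk _ => ?_⟩
    rw [Nat.div_eq_zero_iff]
    right; simpa using hk
  | succ n ih =>
    obtain ⟨a, ha, hanc⟩ := ih fun m hm => h m (by omega)
    have hlt : ∀ b, b / 2 = a → b < 2 ^ (n + 1) := fun b hb => by
      rw [pow_succ]; omega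
    have hhull : ∀ m k, (J ∩ towerBase (n + 1 + m + 1) k).Nonempty →
        ∃ x ∈ J, x ∈ towerHull (n + 2) (k / 2 ^ m) := fun m k ⟨x, hxJ, hx⟩ =>
      ⟨x, hxJ, towerHull_add_subset (n + 1) m k (towerBase_subset_towerHull _ _ hx)⟩
    have hpar : ∀ m k, k < 2 ^ (n + 1 + m) → (J ∩ towerBase (n + 1 + m + 1) k).Nonempty →
        k / 2 ^ m / 2 = a := fun m k hk hne => by
      have e : n + 1 + m = n + (m + 1) := by ring
      rw [e] at hk hne
      rw [Nat.div_div_eq_div_mul, ← pow_succ]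
      exact hanc (m + 1) k hk hne
    by_cases hex : ∃ m k, k < 2 ^ (n + 1 + m) ∧ (J ∩ towerBase (n + 1 + m + 1) k).Nonempty
    · obtain ⟨m₀, k₀, hk₀, hne₀⟩ := hex
      refine ⟨k₀ / 2 ^ m₀, hlt _ (hpar _ _ hk₀ hne₀), fun m k hk hne => ?_⟩
      have key : ∀ m k m' k', k < 2 ^ (n + 1 + m) → k' < 2 ^ (n + 1 + m') →
          (J ∩ towerBase (n + 1 + m + 1) k).Nonempty →
          (J ∩ towerBase (n + 1 + m' + 1) k').Nonempty →
          Even (k / 2 ^ m) → ¬ Even (k' / 2 ^ m') → False := by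
        intro m k m' k' hk hk' hne hne' he ho
        obtain ⟨x, hxJ, hx⟩ := hhull m k hne
        obtain ⟨y, hyJ, hy⟩ := hhull m' k' hne'
        have hx := towerHull_left he hx
        have hy := towerHull_right ho hy
        rw [hpar _ _ hk hne] at hx
        rw [hpar _ _ hk' hne'] at hy
        have h1 := towerDist_pos (n + 1)
        have h2 := towerWidth_pos (n + 1)
        refine h n (by omega) a ha ⟨towerLeft (n + 1) a, hJ.out hxJ hyJ ⟨?_, ?_⟩, ?_, ?_⟩
        · linarith [hx.2]
        · linarith [hy.1]
        · exact le_rfl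
        · linarith
      have hp := hpar _ _ hk hne
      have hp₀ := hpar _ _ hk₀ hne₀
      by_cases he : Even (k / 2 ^ m) <;> by_cases he₀ : Even (k₀ / 2 ^ m₀)
      · rw [Nat.even_iff] at he he₀; omega
      · exact (key _ _ _ _ hk hk₀ hne hne₀ he he₀).elim
      · exact (key _ _ _ _ hk₀ hk hne₀ hne he₀ he).elim
      · rw [Nat.even_iff] at he he₀; omega
    · push Not at hex
      exact ⟨2 * a, hlt _ (by omega), fun m k hk hne => absurd hne (by simp [hex m k hk])⟩

/-- Strict descendants of a tower stay at distance at least `d_i / 2` from it. -/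
theorem towerHull_descendant_far {n a m k : ℕ} (h : k / 2 ^ (m + 1) = a) {x y : ℝ}
    (hx : x ∈ towerHull (n + (m + 1) + 1) k) (hy : y ∈ towerBase (n + 1) a) :
    towerDist (n + 1) / 2 ≤ |x - y| := by
  have e : n + (m + 1) + 1 = (n + 1) + m + 1 := by ring
  rw [e] at hx
  have hx := towerHull_add_subset (n + 1) m k hx
  have hpar : k / 2 ^ m / 2 = a := by rw [Nat.div_div_eq_div_mul, ← pow_succ, h]
  by_cases he : Even (k / 2 ^ m)
  · have hx := towerHull_left he hx
    rw [hpar] at hx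
    rw [abs_sub_comm]
    exact le_trans (by linarith [hx.2, hy.1]) (le_abs_self _)
  · have hx := towerHull_right he hx
    rw [hpar] at hx
    exact le_trans (by linarith [hx.1, hy.2]) (le_abs_self _)

/-- If an interval meets some tower, there is a tower `(n + 1, a)` of smallest generation that it
meets, and all others that it meets are strict descendants of that one. -/
theorem exists_top_tower {J : Set ℝ} (hJ : J.OrdConnected)
    (h : ∃ n, ∃ k < 2 ^ n, (J ∩ towerBase (n + 1) k).Nonempty) :
    ∃ n, ∃ a < 2 ^ n, (J ∩ towerBase (n + 1) a).Nonempty ∧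
      (∀ m < n, ∀ k < 2 ^ m, ¬ (J ∩ towerBase (m + 1) k).Nonempty) ∧
      ∀ m k, k < 2 ^ (n + m) → (J ∩ towerBase (n + m + 1) k).Nonempty → k / 2 ^ m = a := by
  classical
  have hmin : ∀ m < Nat.find h, ∀ k < 2 ^ m, ¬ (J ∩ towerBase (m + 1) k).Nonempty :=
    fun m hm k hk hne => Nat.find_min h hm ⟨k, hk, hne⟩
  obtain ⟨a, ha, hanc⟩ := exists_common_ancestor hJ (Nat.find h) hmin
  obtain ⟨k, hk, hne⟩ := Nat.find_spec h
  have := hanc 0 k (by simpa using hk) (by simpa using hne)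
  simp only [pow_zero, Nat.div_one] at this
  subst this
  exact ⟨_, k, ha, hne, hmin, hanc⟩

theorem towerBase_disjoint {n k m l : ℕ} (hk : k < 2 ^ n) (hl : l < 2 ^ m) {x : ℝ}
    (hx : x ∈ towerBase (n + 1) k) (hx' : x ∈ towerBase (m + 1) l) : n = m ∧ k = l := by
  obtain ⟨i, a, ha, ⟨y, rfl, hxa⟩, hmin, hanc⟩ :=
    exists_top_tower (J := {x}) ordConnected_singleton ⟨n, k, hk, x, rfl, hx⟩
  have key : ∀ m l, l < 2 ^ m → y ∈ towerBase (m + 1) l → m = i ∧ l = a := by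
    intro m l hl hy
    obtain ⟨j, rfl⟩ : ∃ j, m = i + j := by
      refine Nat.exists_eq_add_of_le (not_lt.1 fun hlt => ?_)
      exact hmin m hlt l hl ⟨y, rfl, hy⟩
    have h1 := hanc j l hl ⟨y, rfl, hy⟩
    cases j with
    | zero => simpa using h1
    | succ j =>
      have h2 := towerHull_descendant_far h1 (towerBase_subset_towerHull _ _ hy) hxa
      have h3 := towerDist_pos (i + 1)
      simp at h2
      linarith
  have h1 := key n k hk hx
  have h2 := key m l hl hx'
  omega

/-! ### Functions in `L^p` -/

theorem ofReal_oscTerm_le_lintegral {p : ℝ} (hp : 1 ≤ p) {f : ℝ → ℝ} {J : Set ℝ}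
    (hf : IntegrableOn f J) (h0 : volume J ≠ 0) (h1 : volume J ≠ ⊤) (c : ℝ) :
    ENNReal.ofReal (oscTerm p f J) ≤ 2 ^ p * ∫⁻ x in J, ‖f x - c‖ₑ ^ p := by
  have hfc : IntegrableOn (fun x => f x - c) J := hf.sub (integrableOn_const h1)
  have hp0 : 0 < p := by linarith
  have hV : 0 < volume.real J := ENNReal.toReal_pos h0 h1
  have hI : ENNReal.ofReal (∫ x in J, |f x - c|) = ∫⁻ x in J, ‖f x - c‖ₑ := by
    simpa using ofReal_integral_norm_eq_lintegral_enorm hfc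
  have hI0 : 0 ≤ ∫ x in J, |f x - c| := integral_nonneg fun x => abs_nonneg _
  have hle := oscTerm_le hp0.le hf h0 h1 c
  rw [setAverage_eq, smul_eq_mul] at hle
  refine (ENNReal.ofReal_le_ofReal hle).trans ?_
  rw [ENNReal.ofReal_mul hV.le, ← ENNReal.ofReal_rpow_of_nonneg (by positivity) hp0.le,
    ENNReal.ofReal_mul (by norm_num), ENNReal.ofReal_mul (by positivity),
    ENNReal.ofReal_inv_of_pos hV, hI, measureReal_def, ENNReal.ofReal_toReal h1,
    ENNReal.mul_rpow_of_nonneg _ _ hp0.le, ENNReal.ofReal_ofNat, mul_left_comm]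
  refine mul_le_mul_right ?_ _
  have hprob : IsProbabilityMeasure ((volume J)⁻¹ • volume.restrict J : Measure ℝ) :=
    ⟨by simp [ENNReal.inv_mul_cancel h0 h1]⟩
  have hJensen := eLpNorm_le_eLpNorm_of_exponent_le (p := 1) (q := ENNReal.ofReal p)
    (by simpa using ENNReal.ofReal_le_ofReal hp)
    (μ := (volume J)⁻¹ • volume.restrict J) (f := fun x => f x - c)
    (hfc.aestronglyMeasurable.smul_measure _)
  rw [eLpNorm_one_eq_lintegral_enorm,
    eLpNorm_eq_lintegral_rpow_enorm_toReal (by simpa using hp0) ENNReal.ofReal_ne_top,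
    ENNReal.toReal_ofReal hp0.le, lintegral_smul_measure, lintegral_smul_measure] at hJensen
  have h2 := ENNReal.rpow_le_rpow hJensen hp0.le
  rw [← ENNReal.rpow_mul, one_div_mul_cancel hp0.ne', ENNReal.rpow_one, smul_eq_mul,
    smul_eq_mul] at h2
  refine (mul_le_mul_right h2 _).trans ?_
  rw [← mul_assoc, ENNReal.mul_inv_cancel h0 h1, one_mul]

/-- Approximating `f` in `L^p` by a uniformly continuous function, one gets the majorants required
by `memVJN_of_majorant`. -/
theorem exists_majorant_of_memLp {p : ℝ} (hp : 1 < p) {Q : Set ℝ} (hQ : volume Q ≠ ⊤)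
    {f : ℝ → ℝ} (hf : MemLp f (ENNReal.ofReal p) (volume.restrict Q))
    {ε : ENNReal} (hε : 0 < ε) : ∃ δ : ℝ, 0 < δ ∧ ∃ μ : Measure ℝ, μ univ ≤ ε ∧
      ∀ J ⊆ Q, J.OrdConnected → J.Nontrivial → volume.real J ≤ δ →
        ENNReal.ofReal (oscTerm p f J) ≤ μ J := by
  have hp0 : 0 < p := by linarith
  have : IsFiniteMeasure (volume.restrict Q) := ⟨by simpa using hQ.lt_top⟩
  have hfi : IntegrableOn f Q := hf.integrable (by simpa using ENNReal.ofReal_le_ofReal hp.le)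
  obtain ⟨ε', hε', hε'le⟩ : ∃ ε' : ENNReal, 0 < ε' ∧ 2 ^ p * (2 * ε') ^ p ≤ ε := by
    have ht : Tendsto (fun t : ENNReal => 2 ^ p * (2 * t) ^ p) (𝓝 0) (𝓝 0) := by
      have : Tendsto (fun t : ENNReal => 2 ^ p * (2 * t) ^ p) (𝓝 0)
          (𝓝 (2 ^ p * (2 * 0) ^ p)) := by
        refine ENNReal.Tendsto.const_mul ?_ (Or.inr (by simp))
        exact ((ENNReal.continuous_rpow_const).tendsto _).comp
          (ENNReal.Tendsto.const_mul tendsto_id (Or.inr (by simp)))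
      simpa [hp0] using this
    have h1 := (ENNReal.tendsto_nhds_zero.1 ht ε hε)
    have h2 : ∀ᶠ t : ENNReal in 𝓝[>] 0, 2 ^ p * (2 * t) ^ p ≤ ε := h1.filter_mono inf_le_left
    obtain ⟨t, ht, ht0⟩ := (h2.and self_mem_nhdsWithin).exists
    exact ⟨t, ht0, ht⟩
  obtain ⟨g, hgc, hfg, hg, hgLp⟩ := hf.exists_hasCompactSupport_eLpNorm_sub_le
    ENNReal.ofReal_ne_top hε'.ne'
  have hgu := hgc.uniformContinuous_of_continuous hg
  obtain ⟨η, hη, hηle⟩ : ∃ η : ℝ, 0 < η ∧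
      eLpNorm (fun _ : ℝ => η) (ENNReal.ofReal p) (volume.restrict Q) ≤ ε' := by
    have ht : Tendsto (fun t : ℝ => ENNReal.ofReal t * volume Q ^ (1 / p)) (𝓝 0) (𝓝 0) := by
      have : Tendsto (fun t : ℝ => ENNReal.ofReal t * volume Q ^ (1 / p)) (𝓝 0)
          (𝓝 (ENNReal.ofReal 0 * volume Q ^ (1 / p))) :=
        ENNReal.Tendsto.mul_const ((ENNReal.continuous_ofReal).tendsto 0)
          (Or.inr (ENNReal.rpow_ne_top_of_nonneg (by positivity) hQ))
      simpa using this
    have h2 : ∀ᶠ t : ℝ in 𝓝[>] 0, ENNReal.ofReal t * volume Q ^ (1 / p) ≤ ε' :=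
      (ENNReal.tendsto_nhds_zero.1 ht ε' hε').filter_mono inf_le_left
    obtain ⟨t, ht, ht0⟩ := (h2.and self_mem_nhdsWithin).exists
    refine ⟨t, ht0, ?_⟩
    rw [eLpNorm_const' _ (by simpa using hp0) ENNReal.ofReal_ne_top]
    simpa [ENNReal.toReal_ofReal hp0.le, Real.enorm_eq_ofReal (le_of_lt ht0)] using ht
  obtain ⟨δ, hδ, hgδ⟩ := Metric.uniformContinuous_iff.1 hgu η hη
  set u : ℝ → ℝ := fun x => |f x - g x| + η with hu
  have hum : AEStronglyMeasurable (fun x => f x - g x) (volume.restrict Q) :=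
    hf.1.sub hgLp.1
  refine ⟨δ / 2, by positivity, (volume.restrict Q).withDensity fun x => 2 ^ p * ‖u x‖ₑ ^ p,
    ?_, fun J hJQ hJo hJn hJδ => ?_⟩
  · rw [withDensity_apply _ MeasurableSet.univ, Measure.restrict_univ,
      lintegral_const_mul' _ _ (ENNReal.rpow_ne_top_of_nonneg hp0.le (by simp))]
    refine le_trans (mul_le_mul_right ?_ _) hε'le
    have hnorm : eLpNorm u (ENNReal.ofReal p) (volume.restrict Q) ≤ 2 * ε' := by
      rw [two_mul]
      refine (eLpNorm_add_le hum.norm aestronglyMeasurable_const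
        (by simpa using ENNReal.ofReal_le_ofReal hp.le)).trans (add_le_add ?_ hηle)
      rw [eLpNorm_norm]
      exact hfg
    rw [eLpNorm_eq_lintegral_rpow_enorm_toReal (by simpa using hp0) ENNReal.ofReal_ne_top,
      ENNReal.toReal_ofReal hp0.le] at hnorm
    have h2 := ENNReal.rpow_le_rpow hnorm hp0.le
    rwa [← ENNReal.rpow_mul, one_div_mul_cancel hp0.ne', ENNReal.rpow_one] at h2
  · have hJfin : volume J ≠ ⊤ := ne_top_of_le_ne_top hQ (measure_mono hJQ)
    obtain ⟨x₀, hx₀⟩ := hJn.nonempty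
    refine (ofReal_oscTerm_le_lintegral hp.le (hfi.mono_set hJQ)
      (volume_pos_of_ordConnected hJo hJn).ne' hJfin (g x₀)).trans ?_
    rw [withDensity_apply _ hJo.measurableSet, Measure.restrict_restrict hJo.measurableSet,
      inter_eq_left.2 hJQ,
      lintegral_const_mul' _ _ (ENNReal.rpow_ne_top_of_nonneg hp0.le (by simp))]
    refine mul_le_mul_right (setLIntegral_mono' hJo.measurableSet fun x hx => ?_) _
    refine ENNReal.rpow_le_rpow ?_ hp0.le
    rw [enorm_le_iff_norm_le, Real.norm_eq_abs, Real.norm_eq_abs]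
    refine le_trans ?_ (le_abs_self _)
    have hd : dist x x₀ < δ := by
      have hsub : uIcc x x₀ ⊆ J := hJo.uIcc_subset hx hx₀
      have h1 : volume.real (uIcc x x₀) ≤ volume.real J := measureReal_mono hsub hJfin
      rw [measureReal_def, Real.volume_interval, ENNReal.toReal_ofReal (abs_nonneg _)] at h1
      rw [Real.dist_eq, abs_sub_comm]
      linarith
    have h2 := (hgδ hd).le
    rw [Real.dist_eq] at h2
    exact (abs_sub_le _ (g x) _).trans (add_le_add_right h2 _)

theorem memVJN_of_memLp {p : ℝ} (hp : 1 < p) {Q : Set ℝ} (hQ : volume Q ≠ ⊤)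
    {f : ℝ → ℝ} (hf : MemLp f (ENNReal.ofReal p) (volume.restrict Q)) : MemVJN p Q f := by
  have : IsFiniteMeasure (volume.restrict Q) := ⟨by simpa using hQ.lt_top⟩
  exact memVJN_of_majorant hp hQ
    (hf.integrable (by simpa using ENNReal.ofReal_le_ofReal hp.le))
    fun ε hε => exists_majorant_of_memLp hp hQ hf hε

/-! ### Sizes of the towers and weights of their endpoints -/

theorem towerHeight_nonneg (p : ℝ) (i : ℕ) : 0 ≤ towerHeight p i :=
  Real.rpow_nonneg (by positivity) _

theorem towerHeight_rpow {p : ℝ} (hp : 0 < p) (i : ℕ) :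
    towerHeight p i ^ p = (2 : ℝ) ^ ((i : ℝ) ^ 2) / i := by
  rw [towerHeight, ← Real.rpow_mul (by positivity), one_div_mul_cancel hp.ne', Real.rpow_one]
  congr 1
  rw [← Real.rpow_natCast]
  push_cast
  rfl

theorem towerHeight_rpow_mul_towerWidth {p : ℝ} (hp : 0 < p) (n : ℕ) :
    2 ^ n * (towerHeight p (n + 1) ^ p * towerWidth (n + 1)) =
      (2 : ℝ) ^ (-(5 / 4) : ℝ) / (n + 1) := by
  rw [towerHeight_rpow hp, towerWidth, ← Real.rpow_natCast, div_mul_eq_mul_div,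
    ← Real.rpow_add two_pos, mul_div_assoc', ← Real.rpow_add two_pos]
  push_cast
  congr 2
  ring

theorem towerHeight_mul_towerWidth_le {p : ℝ} (hp : 0 < p) (n : ℕ) :
    towerHeight p (n + 1) * towerWidth (n + 1) ≤
      (2 : ℝ) ^ (-((n + 1 : ℝ) ^ 2 * (1 - 1 / p)) - (n + 1)) := by
  have h1 : towerHeight p (n + 1) ≤ (2 : ℝ) ^ ((n + 1 : ℝ) ^ 2 * (1 / p)) := by
    rw [towerHeight, Real.rpow_mul two_pos.le]
    refine Real.rpow_le_rpow (by positivity) ?_ (by positivity)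
    have h2 : (2 : ℝ) ^ ((n + 1 : ℝ) ^ 2) = 2 ^ ((n + 1) ^ 2) := by
      exact_mod_cast Real.rpow_natCast 2 ((n + 1) ^ 2)
    rw [h2]
    exact div_le_self (by positivity) (by push_cast; linarith [(Nat.cast_nonneg n : (0 : ℝ) ≤ n)])
  refine (mul_le_mul_of_nonneg_right h1 (towerWidth_pos _).le).trans ?_
  rw [towerWidth, ← Real.rpow_add two_pos]
  refine Real.rpow_le_rpow_of_exponent_le one_le_two ?_
  push_cast
  nlinarith [(Nat.cast_nonneg n : (0 : ℝ) ≤ n)]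

/-- Twice the sum of the geometric series that dominates the sizes of the descendants in
`tsum_towerHeight_mul_towerWidth_le`. -/
noncomputable def geomConst (p : ℝ) : ℝ := 2 * (1 - (2 : ℝ) ^ (-(1 - 1 / p)))⁻¹

theorem two_rpow_neg_lt_one {p : ℝ} (hp : 1 < p) : (2 : ℝ) ^ (-(1 - 1 / p)) < 1 := by
  refine Real.rpow_lt_one_of_one_lt_of_neg one_lt_two ?_
  have : 1 / p < 1 := (div_lt_one (by linarith)).2 hp
  linarith

theorem geomConst_pos {p : ℝ} (hp : 1 < p) : 0 < geomConst p := by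
  have := two_rpow_neg_lt_one hp
  unfold geomConst
  have : 0 < 1 - (2 : ℝ) ^ (-(1 - 1 / p)) := by linarith
  positivity

/-- A bound for the integral of the tower function over the strict descendants of a tower of
generation `n + 1`. -/
noncomputable def descendantBound (p : ℝ) (n : ℕ) : ℝ :=
  geomConst p * (2 : ℝ) ^ (-((n + 2 : ℝ) ^ 2 * (1 - 1 / p)) - (n + 2))

theorem tsum_towerHeight_mul_towerWidth_le {p : ℝ} (hp : 1 < p) (n : ℕ) :
    ∑' m : ℕ, ENNReal.ofReal
      (2 ^ (m + 1) * (towerHeight p (n + m + 2) * towerWidth (n + m + 2))) ≤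
      ENNReal.ofReal (descendantBound p n) := by
  set ρ : ℝ := (2 : ℝ) ^ (-(1 - 1 / p)) with hρ
  have hρ1 : ρ < 1 := two_rpow_neg_lt_one hp
  have hρ0 : 0 ≤ ρ := by positivity
  have hθ : 0 < 1 - 1 / p := by
    have : 1 / p < 1 := (div_lt_one (by linarith)).2 hp
    linarith
  set B : ℝ := (2 : ℝ) ^ (-((n + 2 : ℝ) ^ 2 * (1 - 1 / p)) - (n + 2)) with hB
  have hterm : ∀ m : ℕ, 2 ^ (m + 1) * (towerHeight p (n + m + 2) * towerWidth (n + m + 2)) ≤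
      2 * B * ρ ^ m := by
    intro m
    have h1 := towerHeight_mul_towerWidth_le (p := p) (by linarith) (n + m + 1)
    refine (mul_le_mul_of_nonneg_left h1 (by positivity)).trans ?_
    rw [hρ, hB, ← Real.rpow_mul_natCast two_pos.le, pow_succ', mul_assoc, mul_assoc,
      ← Real.rpow_natCast 2 m, ← Real.rpow_add two_pos, ← Real.rpow_add two_pos]
    refine mul_le_mul_of_nonneg_left (Real.rpow_le_rpow_of_exponent_le one_le_two ?_) two_pos.le
    push_cast
    have hn : (0 : ℝ) ≤ n := Nat.cast_nonneg n
    have hm : (0 : ℝ) ≤ m := Nat.cast_nonneg m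
    have h2 : (n + 2 : ℝ) ^ 2 + m ≤ (n + m + 1 + 1 : ℝ) ^ 2 := by nlinarith
    nlinarith [mul_le_mul_of_nonneg_right h2 hθ.le]
  have hs : HasSum (fun m : ℕ => 2 * B * ρ ^ m) (2 * B * (1 - ρ)⁻¹) :=
    (hasSum_geometric_of_lt_one hρ0 hρ1).mul_left _
  calc _ ≤ ∑' m : ℕ, ENNReal.ofReal (2 * B * ρ ^ m) :=
        ENNReal.tsum_le_tsum fun m => ENNReal.ofReal_le_ofReal (hterm m)
    _ = ENNReal.ofReal (2 * B * (1 - ρ)⁻¹) := by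
        rw [← ENNReal.ofReal_tsum_of_nonneg (fun m => by positivity) hs.summable, hs.tsum_eq]
    _ = _ := by rw [descendantBound, geomConst]; congr 1; ring

/-- The mass given to each endpoint of a tower of generation `n + 1`. The first summand is
summable over all towers, although barely so: the descendants of a tower still carry a mass
comparable with `‖h 1_T‖_p ^ p`, see `towerHeight_rpow_mul_towerWidth_le_tsum`. The second summand accounts for the
`descendantBound`, see `towerDist_rpow_mul_descendantBound_le`. -/
noncomputable def endpointWeight (p : ℝ) (n : ℕ) : ℝ :=
  (2 ^ n)⁻¹ * (1 / ((n + 1) * (n + 2)) + ((2 : ℝ) ^ (1 - p)) ^ n)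

theorem endpointWeight_nonneg (p : ℝ) (n : ℕ) : 0 ≤ endpointWeight p n := by
  unfold endpointWeight; positivity

theorem hasSum_telescope (n : ℕ) :
    HasSum (fun m : ℕ => 1 / ((n + m + 1 : ℝ) * (n + m + 2))) (1 / (n + 1)) := by
  rw [hasSum_iff_tendsto_nat_of_nonneg fun m => by positivity]
  have h1 : ∀ N : ℕ, ∑ m ∈ Finset.range N, 1 / ((n + m + 1 : ℝ) * (n + m + 2)) =
      1 / (n + 1) - 1 / ((N : ℝ) + (n + 1)) := by
    intro N
    induction N with
    | zero => simp
    | succ N ih =>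
      rw [Finset.sum_range_succ, ih]
      have : (n : ℝ) + 1 ≠ 0 := by positivity
      have : (n : ℝ) + N + 1 ≠ 0 := by positivity
      have : (n : ℝ) + N + 2 ≠ 0 := by positivity
      have : (N : ℝ) + (n + 1) ≠ 0 := by positivity
      have : ((N + 1 : ℕ) : ℝ) + (n + 1) ≠ 0 := by positivity
      push_cast at this ⊢
      field_simp
      ring
  simp_rw [h1]
  have h2 : Tendsto (fun N : ℕ => 1 / ((N : ℝ) + (n + 1))) atTop (𝓝 0) := by
    simp_rw [one_div]
    exact tendsto_inv_atTop_zero.comp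
      (tendsto_atTop_add_const_right _ _ tendsto_natCast_atTop_atTop)
  simpa using h2.const_sub (1 / ((n : ℝ) + 1))

theorem summable_endpointWeight {p : ℝ} (hp : 1 < p) :
    Summable fun n : ℕ => 2 ^ n * endpointWeight p n := by
  have h1 : Summable fun n : ℕ => 1 / ((n + 1 : ℝ) * (n + 2)) := by
    simpa using (hasSum_telescope 0).summable
  have h2 : Summable fun n : ℕ => ((2 : ℝ) ^ (1 - p)) ^ n :=
    summable_geometric_of_lt_one (by positivity)
      (Real.rpow_lt_one_of_one_lt_of_neg one_lt_two (by linarith))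
  refine (h1.add h2).congr fun n => ?_
  rw [endpointWeight, mul_inv_cancel_left₀ (by positivity)]

theorem towerHeight_rpow_mul_towerDist_le {p : ℝ} (hp : 0 < p) (n : ℕ) :
    towerHeight p (n + 1) ^ p * towerDist (n + 1) ≤ endpointWeight p n := by
  have h1 : (2 : ℝ) ^ n * (2 ^ n * (towerHeight p (n + 1) ^ p * towerDist (n + 1))) =
      1 / (8 * (n + 1)) := by
    rw [towerHeight_rpow hp, towerDist, ← Real.rpow_natCast, div_mul_eq_mul_div,
      ← Real.rpow_add two_pos, mul_div_assoc', ← Real.rpow_add two_pos, mul_div_assoc',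
      ← Real.rpow_add two_pos]
    have : (n : ℝ) + (n + (((n + 1 : ℕ) : ℝ) ^ 2 + -(((n + 1 : ℕ) : ℝ) + 1) ^ 2)) = -3 := by
      push_cast; ring
    rw [this, Real.rpow_neg two_pos.le]
    push_cast
    norm_num
    ring
  have h2 : (n + 2 : ℝ) ≤ 8 * 2 ^ n := by
    have h3 : ((n : ℕ) : ℝ) ≤ 2 ^ n := by exact_mod_cast Nat.lt_two_pow_self.le
    have h4 : (1 : ℝ) ≤ 2 ^ n := one_le_pow₀ one_le_two
    linarith
  have h3 : 1 / (8 * ((n : ℝ) + 1)) ≤ 2 ^ n * (1 / ((n + 1) * (n + 2))) := by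
    rw [mul_one_div, div_le_div_iff₀ (by positivity) (by positivity)]
    nlinarith [mul_le_mul_of_nonneg_left h2 (by positivity : (0 : ℝ) ≤ n + 1)]
  rw [endpointWeight, le_inv_mul_iff₀ (by positivity)]
  refine le_trans ?_ (le_add_of_nonneg_right (by positivity))
  rw [← h1] at h3
  exact le_of_mul_le_mul_left h3 (by positivity)

theorem descendantBound_nonneg {p : ℝ} (hp : 1 < p) (n : ℕ) : 0 ≤ descendantBound p n :=
  mul_nonneg (geomConst_pos hp).le (by positivity)

theorem towerDist_rpow_mul_descendantBound_le {p : ℝ} (hp : 1 < p) (n : ℕ) :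
    (towerDist (n + 1) / 2) ^ (1 - p) * descendantBound p n ^ p ≤
      2 ^ p * geomConst p ^ p * endpointWeight p n := by
  have hp0 : 0 < p := by linarith
  have hd : towerDist (n + 1) / 2 = (2 : ℝ) ^ (-(n + 2 : ℝ) ^ 2 - 1) := by
    rw [towerDist, Real.rpow_sub_one two_ne_zero]
    push_cast
    congr 3
    ring
  have hw : (2 : ℝ) ^ (-(n * p)) ≤ endpointWeight p n := by
    have : (2 : ℝ) ^ (-(n * p)) = (2 ^ n)⁻¹ * ((2 : ℝ) ^ (1 - p)) ^ n := by
      rw [← Real.rpow_mul_natCast two_pos.le, ← Real.rpow_natCast, ← Real.rpow_neg two_pos.le,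
        ← Real.rpow_add two_pos]
      congr 1
      ring
    rw [this, endpointWeight]
    refine mul_le_mul_of_nonneg_left (le_add_of_nonneg_left (by positivity)) (by positivity)
  rw [descendantBound, Real.mul_rpow (geomConst_pos hp).le (by positivity), hd,
    ← Real.rpow_mul two_pos.le, ← Real.rpow_mul two_pos.le, mul_left_comm,
    ← Real.rpow_add two_pos, mul_comm ((2 : ℝ) ^ p), mul_assoc]
  refine mul_le_mul_of_nonneg_left ?_ (Real.rpow_nonneg (geomConst_pos hp).le _)
  refine le_trans ?_ (mul_le_mul_of_nonneg_left hw (by positivity))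
  rw [← Real.rpow_add two_pos]
  refine Real.rpow_le_rpow_of_exponent_le one_le_two ?_
  have : (-((n + 2 : ℝ) ^ 2 * (1 - 1 / p)) - (n + 2)) * p =
      -((n + 2 : ℝ) ^ 2 * (p - 1)) - (n + 2) * p := by
    field_simp
  rw [this]
  nlinarith

theorem towerHeight_rpow_mul_towerWidth_le_tsum {p : ℝ} (hp : 0 < p) (n : ℕ) :
    ENNReal.ofReal (towerHeight p (n + 1) ^ p * towerWidth (n + 1)) ≤
      2 * ∑' m : ℕ, ENNReal.ofReal (2 ^ m * endpointWeight p (n + 1 + m)) := by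
  have hs := (hasSum_telescope (n + 1)).mul_left ((2 : ℝ) ^ (n + 1))⁻¹
  have h1 : ENNReal.ofReal (((2 : ℝ) ^ (n + 1))⁻¹ * (1 / (((n + 1 : ℕ) : ℝ) + 1))) ≤
      ∑' m : ℕ, ENNReal.ofReal (2 ^ m * endpointWeight p (n + 1 + m)) := by
    rw [← hs.tsum_eq, ENNReal.ofReal_tsum_of_nonneg (fun m => by positivity) hs.summable]
    refine ENNReal.tsum_le_tsum fun m => ENNReal.ofReal_le_ofReal ?_
    have h2 : (2 : ℝ) ^ m * (2 ^ (n + 1 + m))⁻¹ = (2 ^ (n + 1))⁻¹ := by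
      rw [pow_add _ (n + 1) m]
      field_simp
    rw [endpointWeight, ← mul_assoc, h2]
    refine mul_le_mul_of_nonneg_left ?_ (by positivity)
    push_cast
    exact le_add_of_nonneg_right (by positivity)
  refine le_trans ?_ (mul_le_mul_right h1 2)
  rw [← ENNReal.ofReal_ofNat 2, ← ENNReal.ofReal_mul two_pos.le]
  refine ENNReal.ofReal_le_ofReal ?_
  refine le_of_mul_le_mul_left ?_ (by positivity : (0 : ℝ) < 2 ^ n)
  rw [towerHeight_rpow_mul_towerWidth hp]
  have h3 : (2 : ℝ) ^ n * (2 * ((2 ^ (n + 1))⁻¹ * (1 / (((n + 1 : ℕ) : ℝ) + 1)))) =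
      1 / (n + 2) := by
    push_cast
    rw [pow_succ]
    field_simp
    ring
  rw [h3]
  have h4 : (2 : ℝ) ^ (-(5 / 4) : ℝ) ≤ 1 / 2 := by
    have : (1 / 2 : ℝ) = 2 ^ (-1 : ℝ) := by rw [Real.rpow_neg_one]; norm_num
    rw [this]
    exact Real.rpow_le_rpow_of_exponent_le one_le_two (by norm_num)
  rw [div_le_div_iff₀ (by positivity) (by positivity)]
  nlinarith [(Nat.cast_nonneg n : (0 : ℝ) ≤ n)]

/-! ### The tower function, one generation at a time -/

/-- The part of the tower function carried by the `2 ^ n` towers of generation `n + 1`. -/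
noncomputable def towerGeneration (p : ℝ) (n : ℕ) (x : ℝ) : ℝ :=
  ∑ k ∈ Finset.range (2 ^ n), (towerBase (n + 1) k).indicator (fun _ => towerHeight p (n + 1)) x

theorem measurableSet_towerBase (i k : ℕ) : MeasurableSet (towerBase i k) := measurableSet_Icc

theorem volume_towerBase (i k : ℕ) : volume (towerBase i k) = ENNReal.ofReal (towerWidth i) := by
  simp [towerBase]

theorem measurable_towerGeneration (p : ℝ) (n : ℕ) : Measurable (towerGeneration p n) :=
  Finset.measurable_fun_sum _ fun _ _ =>
    measurable_const.indicator (measurableSet_towerBase _ _)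

theorem towerGeneration_of_mem {p : ℝ} {n k : ℕ} (hk : k < 2 ^ n) {x : ℝ}
    (hx : x ∈ towerBase (n + 1) k) : towerGeneration p n x = towerHeight p (n + 1) := by
  rw [towerGeneration, Finset.sum_eq_single_of_mem k (Finset.mem_range.2 hk), indicator_of_mem hx]
  intro l hl hlk
  exact indicator_of_notMem
    (fun hx' => hlk (towerBase_disjoint (Finset.mem_range.1 hl) hk hx' hx).2) _

theorem towerGeneration_of_notMem {p : ℝ} {n : ℕ} {x : ℝ}
    (hx : ∀ k < 2 ^ n, x ∉ towerBase (n + 1) k) : towerGeneration p n x = 0 :=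
  Finset.sum_eq_zero fun k hk => indicator_of_notMem (hx k (Finset.mem_range.1 hk)) _

theorem hasSum_towerGeneration_of_mem {p : ℝ} {n k : ℕ} (hk : k < 2 ^ n) {x : ℝ}
    (hx : x ∈ towerBase (n + 1) k) :
    HasSum (fun m => towerGeneration p m x) (towerHeight p (n + 1)) := by
  rw [← towerGeneration_of_mem (p := p) hk hx]
  refine hasSum_single n fun m hm => towerGeneration_of_notMem fun l hl hx' => ?_
  exact hm (towerBase_disjoint hl hk hx' hx).1

theorem unitTowerFun_of_mem {p : ℝ} {n k : ℕ} (hk : k < 2 ^ n) {x : ℝ}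
    (hx : x ∈ towerBase (n + 1) k) : unitTowerFun p x = towerHeight p (n + 1) :=
  (hasSum_towerGeneration_of_mem hk hx).tsum_eq

theorem hasSum_towerGeneration_of_notMem {p : ℝ} {x : ℝ}
    (hx : ∀ n, ∀ k < 2 ^ n, x ∉ towerBase (n + 1) k) :
    HasSum (fun m => towerGeneration p m x) 0 := by
  have : (fun m => towerGeneration p m x) = fun _ => 0 :=
    funext fun m => towerGeneration_of_notMem (hx m)
  rw [this]
  exact hasSum_zero

theorem unitTowerFun_of_notMem {p : ℝ} {x : ℝ}
    (hx : ∀ n, ∀ k < 2 ^ n, x ∉ towerBase (n + 1) k) : unitTowerFun p x = 0 :=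
  (hasSum_towerGeneration_of_notMem hx).tsum_eq

theorem unitTowerFun_nonneg (p : ℝ) (x : ℝ) : 0 ≤ unitTowerFun p x :=
  tsum_nonneg fun _ => Finset.sum_nonneg fun _ _ =>
    indicator_nonneg (fun _ _ => towerHeight_nonneg _ _) _

theorem measurable_unitTowerFun (p : ℝ) : Measurable (unitTowerFun p) := by
  refine measurable_of_tendsto_metrizable
    (f := fun N x => ∑ n ∈ Finset.range N, towerGeneration p n x)
    (fun N => Finset.measurable_fun_sum _ fun n _ => measurable_towerGeneration p n) ?_
  rw [tendsto_pi_nhds]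
  intro x
  have hs : Summable fun n => towerGeneration p n x := by
    by_cases hx : ∀ n, ∀ k < 2 ^ n, x ∉ towerBase (n + 1) k
    · exact (hasSum_towerGeneration_of_notMem hx).summable
    · push Not at hx
      obtain ⟨n, k, hk, hx⟩ := hx
      exact (hasSum_towerGeneration_of_mem hk hx).summable
  exact hs.hasSum.tendsto_sum_nat

/-- On a set which, among the towers, meets only descendants of `(n + 1, a)` of generation at least
`n + 2`, the integral of the tower function is at most the `n`th `descendantBound`. -/
theorem lintegral_unitTowerFun_le {p : ℝ} (hp : 1 < p) {n a : ℕ} {S : Set ℝ}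
    (hS : MeasurableSet S)
    (h : ∀ j, ∀ k < 2 ^ j, (S ∩ towerBase (j + 1) k).Nonempty →
      ∃ m, j = n + m + 1 ∧ k / 2 ^ (m + 1) = a) :
    ∫⁻ x in S, ENNReal.ofReal (unitTowerFun p x) ≤ ENNReal.ofReal (descendantBound p n) := by
  set F : ℕ → ℝ → ENNReal := fun m x =>
    ∑ k ∈ Finset.Ico (a * 2 ^ (m + 1)) ((a + 1) * 2 ^ (m + 1)),
      (towerBase (n + m + 2) k).indicator
        (fun _ => ENNReal.ofReal (towerHeight p (n + m + 2))) x with hF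
  have hle : ∀ x ∈ S, ENNReal.ofReal (unitTowerFun p x) ≤ ∑' m, F m x := by
    intro x hxS
    by_cases hx : ∀ n, ∀ k < 2 ^ n, x ∉ towerBase (n + 1) k
    · simp [unitTowerFun_of_notMem hx]
    · push Not at hx
      obtain ⟨j, k, hk, hx⟩ := hx
      rw [unitTowerFun_of_mem hk hx]
      obtain ⟨m, rfl, hm⟩ := h j k hk ⟨x, hxS, hx⟩
      refine le_trans ?_ (ENNReal.le_tsum m)
      have hmem : k ∈ Finset.Ico (a * 2 ^ (m + 1)) ((a + 1) * 2 ^ (m + 1)) := by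
        rw [Finset.mem_Ico, ← Nat.le_div_iff_mul_le (by positivity),
          ← Nat.div_lt_iff_lt_mul (by positivity)]
        omega
      refine le_trans (le_of_eq ?_) (Finset.single_le_sum (fun _ _ => zero_le) hmem)
      exact (indicator_of_mem (show x ∈ towerBase (n + m + 2) k from hx)
        fun _ => ENNReal.ofReal (towerHeight p (n + m + 2))).symm
  have hFm : ∀ m, Measurable (F m) := fun m => Finset.measurable_fun_sum _ fun _ _ =>
    measurable_const.indicator (measurableSet_towerBase _ _)
  calc ∫⁻ x in S, ENNReal.ofReal (unitTowerFun p x)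
      ≤ ∫⁻ x in S, ∑' m, F m x := setLIntegral_mono' hS hle
    _ ≤ ∫⁻ x, ∑' m, F m x := setLIntegral_le_lintegral _ _
    _ = ∑' m, ∫⁻ x, F m x := lintegral_tsum fun m => (hFm m).aemeasurable
    _ = ∑' m : ℕ, ENNReal.ofReal
          (2 ^ (m + 1) * (towerHeight p (n + m + 2) * towerWidth (n + m + 2))) := by
        congr 1
        ext m
        rw [lintegral_finsetSum _ fun _ _ =>
          measurable_const.indicator (measurableSet_towerBase _ _)]
        simp only [lintegral_indicator (measurableSet_towerBase _ _), lintegral_const,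
          Measure.restrict_apply_univ, volume_towerBase, Finset.sum_const, Nat.card_Ico]
        rw [ENNReal.ofReal_mul (by positivity), ENNReal.ofReal_mul (towerHeight_nonneg _ _),
          nsmul_eq_mul, ← Nat.sub_mul]
        simp [ENNReal.ofReal_pow]
    _ ≤ _ := tsum_towerHeight_mul_towerWidth_le hp n

theorem integrable_unitTowerFun {p : ℝ} (hp : 1 < p) : Integrable (unitTowerFun p) := by
  refine ⟨(measurable_unitTowerFun p).aestronglyMeasurable, ?_⟩
  have henorm : ∀ x, ‖unitTowerFun p x‖ₑ = ENNReal.ofReal (unitTowerFun p x) := fun x =>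
    Real.enorm_eq_ofReal (unitTowerFun_nonneg p x)
  simp only [HasFiniteIntegral, henorm]
  have hB := measurableSet_towerBase 1 0
  rw [← lintegral_add_compl _ hB]
  refine ENNReal.add_lt_top.2 ⟨?_, ?_⟩
  · have : ∀ x ∈ towerBase 1 0,
        ENNReal.ofReal (unitTowerFun p x) ≤ ENNReal.ofReal (towerHeight p 1) := fun x hx => by
      rw [unitTowerFun_of_mem (n := 0) (k := 0) (by simp) hx]
    refine (setLIntegral_mono' hB this).trans_lt ?_
    rw [setLIntegral_const, volume_towerBase]
    exact ENNReal.mul_lt_top ENNReal.ofReal_lt_top ENNReal.ofReal_lt_top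
  · refine (lintegral_unitTowerFun_le hp (n := 0) (a := 0) hB.compl ?_).trans_lt
      ENNReal.ofReal_lt_top
    rintro (_ | j) k hk ⟨x, hx, hxk⟩
    · obtain rfl : k = 0 := by simpa using hk
      exact (hx hxk).elim
    · exact ⟨j, by omega, Nat.div_eq_of_lt hk⟩

/-! ### The majorant of the tower function -/

/-- The measure with an atom of mass `endpointWeight p n` at each of the two endpoints of each
tower of generation `n + 1`, for all `n ≥ N`. -/
noncomputable def endpointMeasure (p : ℝ) (N : ℕ) : Measure ℝ :=
  Measure.sum fun r => ENNReal.ofReal (endpointWeight p (N + r)) •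
    ∑ k ∈ Finset.range (2 ^ (N + r)), (Measure.dirac (towerLeft (N + r + 1) k) +
      Measure.dirac (towerLeft (N + r + 1) k + towerWidth (N + r + 1)))

theorem endpointMeasure_apply {p : ℝ} {N : ℕ} {S : Set ℝ} (hS : MeasurableSet S) :
    endpointMeasure p N S = ∑' r, ENNReal.ofReal (endpointWeight p (N + r)) *
      ∑ k ∈ Finset.range (2 ^ (N + r)), (S.indicator 1 (towerLeft (N + r + 1) k) +
        S.indicator 1 (towerLeft (N + r + 1) k + towerWidth (N + r + 1))) := by
  simp [endpointMeasure, Measure.sum_apply _ hS, Measure.finsetSum_apply, hS]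

theorem tendsto_endpointMeasure_univ {p : ℝ} (hp : 1 < p) :
    Tendsto (fun N => endpointMeasure p N univ) atTop (𝓝 0) := by
  have hw : ∀ n : ℕ, 0 ≤ 2 ^ n * endpointWeight p n := fun n =>
    mul_nonneg (by positivity) (endpointWeight_nonneg p n)
  have h1 : ∀ N, endpointMeasure p N univ =
      ∑' r, 2 * ENNReal.ofReal (2 ^ (r + N) * endpointWeight p (r + N)) := by
    intro N
    rw [endpointMeasure_apply MeasurableSet.univ]
    congr 1
    ext r
    rw [ENNReal.ofReal_mul (by positivity), add_comm r N]
    simp [ENNReal.ofReal_pow, one_add_one_eq_two]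
    ring
  simp_rw [h1, ENNReal.tsum_mul_left]
  have h2 := ENNReal.tendsto_sum_nat_add
    (fun n => ENNReal.ofReal (2 ^ n * endpointWeight p n))
    (summable_endpointWeight hp).tsum_ofReal_ne_top
  simpa using ENNReal.Tendsto.const_mul h2 (Or.inr (by simp : (2 : ENNReal) ≠ ⊤))

theorem endpointWeight_le_endpointMeasure {p : ℝ} {N n k : ℕ} (hN : N ≤ n) (hk : k < 2 ^ n)
    {J : Set ℝ} (hJ : MeasurableSet J)
    (h : towerLeft (n + 1) k ∈ J ∨ towerLeft (n + 1) k + towerWidth (n + 1) ∈ J) :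
    ENNReal.ofReal (endpointWeight p n) ≤ endpointMeasure p N J := by
  obtain ⟨r, rfl⟩ := Nat.exists_eq_add_of_le hN
  rw [endpointMeasure_apply hJ]
  refine le_trans ?_ (ENNReal.le_tsum r)
  refine le_mul_of_one_le_right' ?_
  refine le_trans ?_ (Finset.single_le_sum (fun _ _ => zero_le) (Finset.mem_range.2 hk))
  rcases h with h | h
  · rw [indicator_of_mem h]; exact le_self_add
  · rw [indicator_of_mem h (f := 1)]; exact le_add_self

theorem tsum_le_endpointMeasure {p : ℝ} {N n c : ℕ} (hN : N ≤ n) (hc : c < 2 ^ n)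
    {J : Set ℝ} (hJ : MeasurableSet J) (h : towerHull (n + 1) c ⊆ J) :
    ∑' m : ℕ, ENNReal.ofReal (2 ^ m * endpointWeight p (n + m)) ≤ endpointMeasure p N J := by
  obtain ⟨r, rfl⟩ := Nat.exists_eq_add_of_le hN
  rw [endpointMeasure_apply hJ]
  refine le_trans ?_ (ENNReal.tsum_comp_le_tsum_of_injective (add_right_injective r) _)
  refine ENNReal.tsum_le_tsum fun m => ?_
  rw [mul_comm, ENNReal.ofReal_mul (endpointWeight_nonneg _ _), ← add_assoc]
  refine mul_le_mul_right ?_ _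
  have hsub : Finset.Ico (c * 2 ^ m) ((c + 1) * 2 ^ m) ⊆ Finset.range (2 ^ (N + r + m)) := by
    intro k hk
    rw [Finset.mem_range]
    refine (Finset.mem_Ico.1 hk).2.trans_le ?_
    rw [pow_add]
    exact Nat.mul_le_mul_right _ hc
  refine le_trans ?_ (Finset.sum_le_sum_of_subset hsub)
  have hone : ∀ k ∈ Finset.Ico (c * 2 ^ m) ((c + 1) * 2 ^ m), (1 : ENNReal) ≤
      J.indicator 1 (towerLeft (N + r + m + 1) k) +
        J.indicator 1 (towerLeft (N + r + m + 1) k + towerWidth (N + r + m + 1)) := by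
    intro k hk
    rw [Finset.mem_Ico, ← Nat.le_div_iff_mul_le (by positivity),
      ← Nat.div_lt_iff_lt_mul (by positivity)] at hk
    have hkc : k / 2 ^ m = c := by omega
    have hmem : towerLeft (N + r + m + 1) k ∈ J := by
      refine h ?_
      rw [← hkc]
      refine towerHull_add_subset _ _ _ (towerBase_subset_towerHull _ _ ⟨le_rfl, ?_⟩)
      linarith [towerWidth_pos (N + r + m + 1)]
    rw [indicator_of_mem hmem]
    exact le_self_add
  refine le_trans (le_of_eq ?_) (Finset.sum_le_sum hone)
  rw [Finset.sum_const, Nat.card_Ico, ← Nat.sub_mul]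
  simp [ENNReal.ofReal_pow]

theorem add_rpow_le_two_rpow_mul {p x y : ℝ} (hp : 0 ≤ p) (hx : 0 ≤ x) (hy : 0 ≤ y) :
    (x + y) ^ p ≤ 2 ^ p * (x ^ p + y ^ p) := by
  have h1 : (x + y) ^ p ≤ (2 * max x y) ^ p :=
    Real.rpow_le_rpow (by positivity) (by linarith [le_max_left x y, le_max_right x y]) hp
  rw [Real.mul_rpow two_pos.le (le_max_of_le_left hx)] at h1
  refine h1.trans (mul_le_mul_of_nonneg_left ?_ (by positivity))
  have := Real.rpow_nonneg hx p
  have := Real.rpow_nonneg hy p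
  rcases max_choice x y with h | h <;> rw [h] <;> linarith

theorem mul_rpow_two_mul_inv_mul_le {p V h M D X : ℝ} (hp : 1 ≤ p) (hV : 0 < V) (hh : 0 ≤ h)
    (hM : 0 ≤ M) (hMV : M ≤ V) (hD : 0 ≤ D) (hX0 : 0 ≤ X) (hX : X ≤ h * M + D) :
    V * (2 * (V⁻¹ * X)) ^ p ≤ 4 ^ p * (h ^ p * M + V ^ (1 - p) * D ^ p) := by
  have hp0 : 0 ≤ p := by linarith
  have h1 : (2 * (V⁻¹ * X)) ^ p ≤ 2 ^ p * (h * (M / V) + D / V) ^ p := by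
    rw [← Real.mul_rpow two_pos.le (by positivity)]
    refine Real.rpow_le_rpow (by positivity) ?_ hp0
    refine mul_le_mul_of_nonneg_left ?_ two_pos.le
    rw [mul_div_assoc', ← add_div, inv_mul_eq_div]
    gcongr
  have h2 := add_rpow_le_two_rpow_mul hp0 (by positivity : 0 ≤ h * (M / V))
    (by positivity : 0 ≤ D / V)
  have h3 : (M / V) ^ p ≤ M / V := by
    have := Real.rpow_le_rpow_of_exponent_ge' (by positivity) ((div_le_one hV).2 hMV) zero_le_one hp
    simpa using this
  have h4 : (h * (M / V)) ^ p ≤ h ^ p * (M / V) := by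
    rw [Real.mul_rpow hh (by positivity)]
    exact mul_le_mul_of_nonneg_left h3 (by positivity)
  have h5 : V * (D / V) ^ p = V ^ (1 - p) * D ^ p := by
    rw [Real.div_rpow hD hV.le, Real.rpow_sub hV, Real.rpow_one]
    ring
  have h6 : (4 : ℝ) ^ p = 2 ^ p * 2 ^ p := by
    rw [← Real.mul_rpow two_pos.le two_pos.le]; norm_num
  calc V * (2 * (V⁻¹ * X)) ^ p
      ≤ V * (2 ^ p * (2 ^ p * (h ^ p * (M / V) + (D / V) ^ p))) := by
        refine mul_le_mul_of_nonneg_left (h1.trans ?_) hV.le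
        refine mul_le_mul_of_nonneg_left (h2.trans ?_) (by positivity)
        gcongr
    _ = 4 ^ p * (h ^ p * M + V * (D / V) ^ p) := by rw [h6]; field_simp
    _ = _ := by rw [h5]

theorem endpoint_mem_of_not_subset {J : Set ℝ} (hJ : J.OrdConnected) {i k : ℕ}
    (hne : (J ∩ towerBase i k).Nonempty) (h : ¬ J ⊆ towerBase i k) :
    towerLeft i k ∈ J ∨ towerLeft i k + towerWidth i ∈ J := by
  obtain ⟨y, hyJ, hy⟩ := hne
  obtain ⟨x, hxJ, hx⟩ := not_subset.1 h
  rcases lt_or_ge x (towerLeft i k) with hlt | hge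
  · exact Or.inl (hJ.out hxJ hyJ ⟨hlt.le, hy.1⟩)
  · right
    have hlt : towerLeft i k + towerWidth i < x := by
      by_contra hcon
      exact hx ⟨hge, not_lt.1 hcon⟩
    exact hJ.out hyJ hxJ ⟨hy.2, hlt.le⟩

/-- An interval that meets a tower and leaves its hull contains the hull of one of the two
children. -/
theorem subset_towerHull_or {J : Set ℝ} (hJ : J.OrdConnected) {n a : ℕ}
    (hne : (J ∩ towerBase (n + 1) a).Nonempty) :
    J ⊆ towerHull (n + 1) a ∨ ∃ c, c / 2 = a ∧ towerHull (n + 2) c ⊆ J := by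
  obtain ⟨y, hyJ, hy⟩ := hne
  have hd := towerDist_pos (n + 1)
  by_contra! hcon
  obtain ⟨h1, h2⟩ := hcon
  obtain ⟨x, hxJ, hx⟩ := not_subset.1 h1
  rcases lt_or_ge x (towerLeft (n + 1) a - 2 * towerDist (n + 1)) with hlt | hge
  · have hq : 2 * a / 2 = a := by omega
    refine h2 (2 * a) hq ((towerHull_left (even_two_mul a)).trans ?_)
    rw [hq]
    exact (Icc_subset_Icc hlt.le (by linarith [hy.1])).trans (hJ.out hxJ hyJ)
  · have hlt : towerLeft (n + 1) a + towerWidth (n + 1) + 2 * towerDist (n + 1) < x := by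
      by_contra hcon
      exact hx ⟨hge, not_lt.1 hcon⟩
    have hq : (2 * a + 1) / 2 = a := by omega
    refine h2 (2 * a + 1) hq ((towerHull_right (by simp [parity_simps])).trans ?_)
    rw [hq]
    exact (Icc_subset_Icc (by linarith [hy.2]) hlt.le).trans (hJ.out hyJ hxJ)

theorem volume_towerHull_diff_le (i k : ℕ) :
    volume.real (towerHull i k \ towerBase i k) ≤ 4 * towerDist i := by
  have hd := towerDist_pos i
  have hw := towerWidth_pos i
  rw [measureReal_sdiff (towerBase_subset_towerHull i k) (measurableSet_towerBase i k)
    (by simp [towerHull])]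
  rw [towerHull, towerBase, Real.volume_real_Icc_of_le (by linarith),
    Real.volume_real_Icc_of_le (by linarith)]
  linarith

theorem abs_sub_le_volume_of_ordConnected {J : Set ℝ} (hJ : J.OrdConnected) (hfin : volume J ≠ ⊤)
    {x y : ℝ} (hx : x ∈ J) (hy : y ∈ J) : |x - y| ≤ volume.real J := by
  rw [abs_sub_comm, ← Real.volume_real_interval]
  exact measureReal_mono (hJ.uIcc_subset hx hy) hfin

/-- The constant in `ofReal_oscTerm_unitTowerFun_le`. -/
noncomputable def majorantConst (p : ℝ) : ℝ := 4 ^ p * (4 + 2 ^ p * geomConst p ^ p)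

/-- Let `(n + 1, a)` be the tower of smallest generation that the interval `J` meets. Comparing the
tower function on `J` with the constants `0` and `h`, the oscillation is bounded by a term
`h ^ p * min |J ∩ T| |J \ T|`, and by the integral over the descendants that `J` meets. Then either
`J` stays in the hull of `T`, and `|J \ T|` is at most `4 d`, or `J` swallows all descendants of
one child of `T`, whose endpoints together have mass at least `h ^ p * |T|`. -/
theorem ofReal_oscTerm_unitTowerFun_le {p : ℝ} (hp : 1 < p) {J : Set ℝ} (hJ : J.OrdConnected)
    (hJn : J.Nontrivial) (hfin : volume J ≠ ⊤) {N n a : ℕ} (hN : N ≤ n) (ha : a < 2 ^ n)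
    (hne : (J ∩ towerBase (n + 1) a).Nonempty)
    (hmin : ∀ m < n, ∀ k < 2 ^ m, ¬ (J ∩ towerBase (m + 1) k).Nonempty)
    (hanc : ∀ m k, k < 2 ^ (n + m) → (J ∩ towerBase (n + m + 1) k).Nonempty → k / 2 ^ m = a) :
    ENNReal.ofReal (oscTerm p (unitTowerFun p) J) ≤
      ENNReal.ofReal (majorantConst p) * endpointMeasure p N J := by
  have hp0 : 0 < p := by linarith
  have hJm : MeasurableSet J := hJ.measurableSet
  set T := towerBase (n + 1) a with hT
  set h := towerHeight p (n + 1) with hh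
  set d := towerDist (n + 1) with hd
  have hTm : MeasurableSet T := measurableSet_towerBase _ _
  have hd0 : 0 < d := towerDist_pos _
  have hh0 : 0 ≤ h := towerHeight_nonneg _ _
  set V := volume.real J with hV
  have hV0 : 0 < V := ENNReal.toReal_pos (volume_pos_of_ordConnected hJ hJn).ne' hfin
  set D := ∫ x in J \ T, unitTowerFun p x with hD
  have hint : Integrable (unitTowerFun p) := integrable_unitTowerFun hp
  have hD0 : 0 ≤ D := setIntegral_nonneg (hJm.diff hTm) fun x _ => unitTowerFun_nonneg p x
  have hother : ∀ j, ∀ k < 2 ^ j, ((J \ T) ∩ towerBase (j + 1) k).Nonempty →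
      ∃ m, j = n + m + 1 ∧ k / 2 ^ (m + 1) = a := by
    rintro j k hk ⟨x, ⟨hxJ, hxT⟩, hx⟩
    obtain ⟨m, rfl⟩ : ∃ m, j = n + m := Nat.exists_eq_add_of_le
      (not_lt.1 fun hlt => hmin j hlt k hk ⟨x, hxJ, hx⟩)
    have hka := hanc m k hk ⟨x, hxJ, hx⟩
    cases m with
    | zero =>
      obtain rfl : k = a := by simpa using hka
      exact (hxT hx).elim
    | succ m => exact ⟨m, rfl, hka⟩
  have hDB : D ≤ descendantBound p n := by
    have h1 := lintegral_unitTowerFun_le hp (hJm.diff hTm) hother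
    rw [hD, integral_eq_lintegral_of_nonneg_ae
      (ae_of_all _ fun x => unitTowerFun_nonneg p x) hint.1.restrict]
    exact ENNReal.toReal_le_of_le_ofReal (descendantBound_nonneg hp n) h1
  -- If the integral over the descendants does not vanish, `J` is at least `d / 2` long.
  have hDV : D = 0 ∨ (d / 2 ≤ V ∧ ¬ J ⊆ T) := by
    by_cases hex : ∃ x ∈ J \ T, ∃ j, ∃ k < 2 ^ j, x ∈ towerBase (j + 1) k
    · right
      obtain ⟨x, hx, j, k, hk, hxk⟩ := hex
      refine ⟨?_, fun hsub => hx.2 (hsub hx.1)⟩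
      obtain ⟨m, rfl, hm⟩ := hother j k hk ⟨x, hx, hxk⟩
      obtain ⟨y, hyJ, hyT⟩ := hne
      exact (towerHull_descendant_far hm (towerBase_subset_towerHull _ _ hxk) hyT).trans
        (abs_sub_le_volume_of_ordConnected hJ hfin hx.1 hyJ)
    · left
      refine setIntegral_eq_zero_of_forall_eq_zero fun x hx => unitTowerFun_of_notMem ?_
      intro j k hk hxk
      exact hex ⟨x, hx, j, k, hk, hxk⟩
  set t := volume.real (J ∩ T) with ht
  set m := volume.real (J \ T) with hm
  have htV : t ≤ V := measureReal_mono inter_subset_left hfin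
  have ht0 : 0 ≤ t := measureReal_nonneg
  have hm0 : 0 ≤ m := measureReal_nonneg
  have hosc : ∀ c M, 0 ≤ M → M ≤ V → ∫ x in J, |unitTowerFun p x - c| ≤ h * M + D →
      oscTerm p (unitTowerFun p) J ≤ 4 ^ p * (h ^ p * M + V ^ (1 - p) * D ^ p) := by
    intro c M hM hMV hle
    refine (oscTerm_le hp0.le hint.integrableOn
      (volume_pos_of_ordConnected hJ hJn).ne' hfin c).trans ?_
    rw [setAverage_eq, smul_eq_mul]
    exact mul_rpow_two_mul_inv_mul_le hp.le hV0 hh0 hM hMV hD0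
      (integral_nonneg fun x => abs_nonneg _) hle
  have hsplit : ∀ c, ∫ x in J, |unitTowerFun p x - c| =
      |h - c| * t + ∫ x in J \ T, |unitTowerFun p x - c| := by
    intro c
    have hi : IntegrableOn (fun x => |unitTowerFun p x - c|) J :=
      (hint.integrableOn.sub (integrableOn_const hfin)).abs
    rw [← integral_inter_add_sdiff hTm hi]
    congr 1
    have heq : EqOn (fun x => |unitTowerFun p x - c|) (fun _ => |h - c|) (J ∩ T) := by
      intro x hx
      simp only [unitTowerFun_of_mem ha hx.2, hh]
    rw [setIntegral_congr_fun (hJm.inter hTm) heq, setIntegral_const, smul_eq_mul, mul_comm]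
  have hosct := hosc 0 t ht0 htV (le_of_eq (by
    rw [hsplit, sub_zero, abs_of_nonneg hh0]
    simp only [sub_zero, abs_of_nonneg (unitTowerFun_nonneg p _), hD]))
  have hfinm : volume (J \ T) ≠ ⊤ := ne_top_of_le_ne_top hfin (measure_mono sdiff_subset)
  have hoscm := hosc h m hm0 (measureReal_mono sdiff_subset hfin) (by
    rw [hsplit, sub_self, abs_zero, zero_mul, zero_add, add_comm, mul_comm]
    have : D + m * h = ∫ x in J \ T, (unitTowerFun p x + h) := by
      rw [integral_add hint.integrableOn (integrableOn_const hfinm), setIntegral_const,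
        smul_eq_mul]
    rw [this]
    refine setIntegral_mono (hint.integrableOn.sub (integrableOn_const hfinm)).abs
      (hint.integrableOn.add (integrableOn_const hfinm)) fun x => ?_
    refine (abs_sub _ _).trans (le_of_eq ?_)
    rw [abs_of_nonneg (unitTowerFun_nonneg p x), abs_of_nonneg hh0])
  by_cases hsub : J ⊆ T
  · have hm00 : m = 0 := by rw [hm, sdiff_eq_empty.2 hsub]; simp
    have hD00 : D = 0 := hDV.resolve_right fun hcon => hcon.2 hsub
    rw [hm00, hD00, Real.zero_rpow hp0.ne', mul_zero, mul_zero, add_zero, mul_zero] at hoscm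
    rw [ENNReal.ofReal_of_nonpos hoscm]
    exact zero_le
  have hend : ENNReal.ofReal (endpointWeight p n) ≤ endpointMeasure p N J :=
    endpointWeight_le_endpointMeasure hN ha hJm (endpoint_mem_of_not_subset hJ hne hsub)
  have hDterm : V ^ (1 - p) * D ^ p ≤ 2 ^ p * geomConst p ^ p * endpointWeight p n := by
    rcases hDV with hD00 | ⟨hdV, -⟩
    · rw [hD00, Real.zero_rpow hp0.ne', mul_zero]
      have := (geomConst_pos hp).le
      have := endpointWeight_nonneg p n
      positivity
    · refine le_trans ?_ (towerDist_rpow_mul_descendantBound_le hp n)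
      refine mul_le_mul ?_ (Real.rpow_le_rpow hD0 hDB hp0.le) (by positivity) (by positivity)
      exact Real.rpow_le_rpow_of_nonpos (by positivity) hdV (by linarith)
  have hgc := (geomConst_pos hp).le
  have hfinal : ∀ M, oscTerm p (unitTowerFun p) J ≤ 4 ^ p * (h ^ p * M + V ^ (1 - p) * D ^ p) →
      ENNReal.ofReal (h ^ p * M) ≤ 4 * endpointMeasure p N J →
      ENNReal.ofReal (oscTerm p (unitTowerFun p) J) ≤
        ENNReal.ofReal (majorantConst p) * endpointMeasure p N J := by
    intro M h1 h2
    refine (ENNReal.ofReal_le_ofReal h1).trans ?_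
    rw [ENNReal.ofReal_mul (by positivity), majorantConst, ENNReal.ofReal_mul (by positivity),
      mul_assoc]
    refine mul_le_mul_right ?_ _
    refine ENNReal.ofReal_add_le.trans ?_
    rw [ENNReal.ofReal_add (by positivity) (by positivity), add_mul]
    refine add_le_add ?_ ?_
    · simpa using h2
    · refine (ENNReal.ofReal_le_ofReal hDterm).trans ?_
      rw [ENNReal.ofReal_mul (by positivity)]
      exact mul_le_mul_right hend _
  rcases subset_towerHull_or hJ hne with hin | ⟨c, hc, hcJ⟩
  · refine hfinal m hoscm ?_
    have hm4 : m ≤ 4 * d := (measureReal_mono (sdiff_subset_sdiff_left hin)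
      (ne_top_of_le_ne_top (by simp [towerHull]) (measure_mono sdiff_subset))).trans
      (volume_towerHull_diff_le (n + 1) a)
    refine le_trans ?_ (mul_le_mul_right hend 4)
    rw [← ENNReal.ofReal_ofNat 4, ← ENNReal.ofReal_mul (by norm_num)]
    refine ENNReal.ofReal_le_ofReal ?_
    have h1 := towerHeight_rpow_mul_towerDist_le hp0 n
    have h2 := mul_le_mul_of_nonneg_left hm4 (Real.rpow_nonneg hh0 p)
    simp only [← hh, ← hd] at h1
    linarith
  · refine hfinal t hosct ?_
    have htl : t ≤ towerWidth (n + 1) := by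
      have h1 : t ≤ volume.real T :=
        measureReal_mono inter_subset_right (by simp [hT, volume_towerBase])
      rwa [measureReal_def, hT, volume_towerBase,
        ENNReal.toReal_ofReal (towerWidth_pos _).le] at h1
    have h1 := towerHeight_rpow_mul_towerWidth_le_tsum hp0 n
    have h2 := tsum_le_endpointMeasure (p := p) (N := N) (n := n + 1) (c := c) (by omega)
      (by rw [pow_succ]; omega) hJm hcJ
    calc ENNReal.ofReal (h ^ p * t) ≤ ENNReal.ofReal (h ^ p * towerWidth (n + 1)) :=
          ENNReal.ofReal_le_ofReal (mul_le_mul_of_nonneg_left htl (Real.rpow_nonneg hh0 p))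
      _ ≤ 2 * endpointMeasure p N J := h1.trans (mul_le_mul_right h2 2)
      _ ≤ 4 * endpointMeasure p N J := by gcongr; norm_num

/-! ### Affine changes of variable -/

theorem setIntegral_comp_affine (F : ℝ → ℝ) (a : ℝ) {s : ℝ} (hs : 0 < s) {J : Set ℝ}
    (hJ : MeasurableSet J) :
    ∫ x in J, F ((x - a) / s) = s * ∫ y in (fun y => a + s * y) ⁻¹' J, F y := by
  have hJ' : MeasurableSet ((fun y : ℝ => a + s * y) ⁻¹' J) :=
    (measurable_const.add (measurable_const.mul measurable_id)) hJ
  rw [← integral_indicator hJ, ← integral_indicator hJ']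
  have h1 : J.indicator (fun x => F ((x - a) / s)) =
      fun x => ((fun y => a + s * y) ⁻¹' J).indicator F ((x - a) / s) := by
    ext x
    have hx : a + s * ((x - a) / s) = x := by field_simp; ring
    by_cases hxJ : x ∈ J
    · rw [indicator_of_mem hxJ, indicator_of_mem (by simpa [hx] using hxJ)]
    · rw [indicator_of_notMem hxJ, indicator_of_notMem (by simpa [hx] using hxJ)]
  rw [h1, integral_sub_right_eq_self
    (fun x => ((fun y => a + s * y) ⁻¹' J).indicator F (x / s)) a,
    Measure.integral_comp_div, abs_of_pos hs, smul_eq_mul]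

theorem volume_real_preimage_affine (a : ℝ) {s : ℝ} (hs : 0 < s) {J : Set ℝ}
    (hJ : MeasurableSet J) :
    volume.real J = s * volume.real ((fun y => a + s * y) ⁻¹' J) := by
  simpa using setIntegral_comp_affine (fun _ => 1) a hs hJ

theorem volume_preimage_affine_ne_top (a : ℝ) {s : ℝ} (hs : 0 < s) {J : Set ℝ}
    (hJ : volume J ≠ ⊤) : volume ((fun y => a + s * y) ⁻¹' J) ≠ ⊤ := by
  have : (fun y => a + s * y) ⁻¹' J = (fun y => s * y) ⁻¹' ((fun y => a + y) ⁻¹' J) := rfl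
  rw [this, Real.volume_preimage_mul_left hs.ne', measure_preimage_add]
  exact ENNReal.mul_ne_top ENNReal.ofReal_ne_top hJ

theorem oscTerm_comp_affine (p : ℝ) (F : ℝ → ℝ) (a : ℝ) {s : ℝ} (hs : 0 < s) {J : Set ℝ}
    (hJ : MeasurableSet J) :
    oscTerm p (fun x => F ((x - a) / s)) J = s * oscTerm p F ((fun y => a + s * y) ⁻¹' J) := by
  have havg : ∀ u : ℝ → ℝ, ⨍ x in J, u ((x - a) / s) = ⨍ y in (fun y => a + s * y) ⁻¹' J, u y := by
    intro u
    rw [setAverage_eq, setAverage_eq, setIntegral_comp_affine u a hs hJ,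
      volume_real_preimage_affine a hs hJ, smul_eq_mul, smul_eq_mul, mul_inv, mul_mul_mul_comm,
      inv_mul_cancel₀ hs.ne', one_mul]
  unfold oscTerm
  rw [havg F]
  generalize ⨍ y in (fun y => a + s * y) ⁻¹' J, F y = c
  rw [havg fun y => |F y - c|, volume_real_preimage_affine a hs hJ, mul_assoc]

/-! ### The tower function on a bounded interval -/

theorem integrable_towerFun {p : ℝ} (hp : 1 < p) {a b : ℝ} (hab : a < b) :
    Integrable (towerFun p a b) :=
  ((integrable_unitTowerFun hp).comp_div (sub_pos.2 hab).ne').comp_sub_right a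

/-- The tower function with all towers of generation greater than `N` removed. -/
noncomputable def truncatedTowerFun (p : ℝ) (N : ℕ) (x : ℝ) : ℝ :=
  ∑ n ∈ Finset.range N, towerGeneration p n x

theorem measurable_truncatedTowerFun (p : ℝ) (N : ℕ) : Measurable (truncatedTowerFun p N) :=
  Finset.measurable_fun_sum _ fun n _ => measurable_towerGeneration p n

theorem truncatedTowerFun_eq {p : ℝ} {N : ℕ} {x : ℝ}
    (hx : ∀ n, N ≤ n → ∀ k < 2 ^ n, x ∉ towerBase (n + 1) k) :
    unitTowerFun p x = truncatedTowerFun p N x :=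
  tsum_eq_sum fun n hn => towerGeneration_of_notMem (hx n (by simpa using hn))

theorem norm_truncatedTowerFun_le (p : ℝ) (N : ℕ) (x : ℝ) : ‖truncatedTowerFun p N x‖ ≤
    ∑ n ∈ Finset.range N, ∑ _k ∈ Finset.range (2 ^ n), towerHeight p (n + 1) := by
  refine (norm_sum_le _ _).trans (Finset.sum_le_sum fun n _ => ?_)
  refine (norm_sum_le _ _).trans (Finset.sum_le_sum fun k _ => ?_)
  refine (norm_indicator_le_norm_self _ _).trans (le_of_eq ?_)
  exact abs_of_nonneg (towerHeight_nonneg _ _)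

/-- A short interval that meets some tower of generation greater than `N` meets none of generation
at most `N`, and is handled by `endpointMeasure p N`, whose mass is small for large `N`. On all
other intervals the tower function agrees with a bounded function. -/
theorem memVJN_towerFun {p : ℝ} (hp : 1 < p) {a b : ℝ} (hab : a < b) {Q : Set ℝ}
    (hQ : volume Q ≠ ⊤) : MemVJN p Q (towerFun p a b) := by
  refine memVJN_of_majorant hp hQ (integrable_towerFun hp hab).integrableOn fun ε hε => ?_
  have : IsFiniteMeasure (volume.restrict Q) := ⟨by simpa using hQ.lt_top⟩
  set s := b - a with hs
  have hs0 : 0 < s := sub_pos.2 hab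
  have hψ : Measurable fun y : ℝ => a + s * y :=
    measurable_const.add (measurable_const.mul measurable_id)
  have hε2 : 0 < ε / 2 := ENNReal.half_pos hε.ne'
  set C : ENNReal := ENNReal.ofReal s * ENNReal.ofReal (majorantConst p) with hC
  have hCtop : C ≠ ⊤ := ENNReal.mul_ne_top ENNReal.ofReal_ne_top ENNReal.ofReal_ne_top
  obtain ⟨N, hN⟩ : ∃ N, C * endpointMeasure p N univ ≤ ε / 2 := by
    have h1 := ENNReal.Tendsto.const_mul (tendsto_endpointMeasure_univ hp) (Or.inr hCtop)
    rw [mul_zero] at h1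
    exact (ENNReal.tendsto_nhds_zero.1 h1 _ hε2).exists
  set g : ℝ → ℝ := fun x => truncatedTowerFun p N ((x - a) / s) with hg
  have hgLp : MemLp g (ENNReal.ofReal p) (volume.restrict Q) := by
    refine MemLp.of_bound ?_ _ (ae_of_all _ fun x => norm_truncatedTowerFun_le p N _)
    exact ((measurable_truncatedTowerFun p N).comp
      ((measurable_id.sub_const a).div_const s)).aestronglyMeasurable
  obtain ⟨δ, hδ, μ, hμ, hμJ⟩ := exists_majorant_of_memLp hp hQ hgLp hε2
  have hd := towerDist_pos (N + 1)
  refine ⟨min δ (s * (towerDist (N + 1) / 4)), by positivity,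
    μ + C • (endpointMeasure p N).map (fun y => a + s * y), ?_, fun J hJQ hJo hJn hJδ => ?_⟩
  · rw [Measure.add_apply, Measure.smul_apply, Measure.map_apply hψ MeasurableSet.univ,
      preimage_univ, smul_eq_mul, ← ENNReal.add_halves ε]
    exact add_le_add hμ hN
  have hJm := hJo.measurableSet
  have hJfin : volume J ≠ ⊤ := ne_top_of_le_ne_top hQ (measure_mono hJQ)
  rw [Measure.add_apply, Measure.smul_apply, Measure.map_apply hψ hJm, smul_eq_mul]
  set J' := (fun y : ℝ => a + s * y) ⁻¹' J with hJ'
  have hmem : ∀ x ∈ J, (x - a) / s ∈ J' := fun x hx => by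
    have : a + s * ((x - a) / s) = x := by field_simp; ring
    simpa [hJ', this] using hx
  by_cases hex : ∃ j, N ≤ j ∧ ∃ k < 2 ^ j, (J' ∩ towerBase (j + 1) k).Nonempty
  · refine le_trans ?_ le_add_self
    obtain ⟨j, hNj, k, hk, hne⟩ := hex
    have hmono : Monotone fun y : ℝ => a + s * y := fun x y hxy => by
      simp only
      gcongr
    have hJo' : J'.OrdConnected := hJo.preimage_mono hmono
    have hJn' : J'.Nontrivial := by
      obtain ⟨x, hx, y, hy, hxy⟩ := hJn
      refine ⟨_, hmem x hx, _, hmem y hy, fun hcon => hxy ?_⟩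
      rw [div_left_inj' hs0.ne'] at hcon
      linarith
    have hJfin' : volume J' ≠ ⊤ := volume_preimage_affine_ne_top a hs0 hJfin
    obtain ⟨n, c, hc, hnec, hmin, hanc⟩ := exists_top_tower hJo' ⟨j, k, hk, hne⟩
    have hNn : N ≤ n := by
      by_contra! hlt
      obtain ⟨m, rfl⟩ : ∃ m, j = n + (m + 1) := ⟨j - n - 1, by omega⟩
      have hkc := hanc (m + 1) k hk hne
      obtain ⟨x, hx, hxk⟩ := hne
      obtain ⟨y, hy, hyc⟩ := hnec
      have h1 := (towerHull_descendant_far hkc (towerBase_subset_towerHull _ _ hxk) hyc).trans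
        (abs_sub_le_volume_of_ordConnected hJo' hJfin' hx hy)
      have h2 := hJδ.trans (min_le_right _ _)
      rw [volume_real_preimage_affine a hs0 hJm] at h2
      have h3 := le_of_mul_le_mul_left h2 hs0
      have h4 : towerDist (N + 1) ≤ towerDist (n + 1) := towerDist_anti (by omega)
      linarith
    have hosc : oscTerm p (towerFun p a b) J = s * oscTerm p (unitTowerFun p) J' :=
      oscTerm_comp_affine p (unitTowerFun p) a hs0 hJm
    rw [hosc, ENNReal.ofReal_mul hs0.le, hC, mul_assoc]
    exact mul_le_mul_right
      (ofReal_oscTerm_unitTowerFun_le hp hJo' hJn' hJfin' hNn hc hnec hmin hanc) _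
  · refine le_trans ?_ le_self_add
    have heq : EqOn (towerFun p a b) g J := fun x hx =>
      truncatedTowerFun_eq fun n hn k hk hxk => hex ⟨n, hn, k, hk, _, hmem x hx, hxk⟩
    rw [oscTerm_congr hJm heq]
    exact hμJ J hJQ hJo hJn (hJδ.trans (min_le_left _ _))

theorem towerBase_subset_Ioo {n k : ℕ} (hk : k < 2 ^ n) : towerBase (n + 1) k ⊆ Ioo 0 1 := by
  have h0 : towerBase (n + 1) k ⊆ towerHull 1 0 := by
    have := towerHull_add_subset 0 n k
    rw [Nat.div_eq_of_lt hk, zero_add] at this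
    exact (towerBase_subset_towerHull _ _).trans this
  have hw : towerWidth 1 ≤ 1 / 4 := by
    have : (1 / 4 : ℝ) = 2 ^ (-2 : ℝ) := by rw [Real.rpow_neg two_pos.le]; norm_num
    rw [this, towerWidth]
    exact Real.rpow_le_rpow_of_exponent_le one_le_two (by norm_num)
  have hd : towerDist 1 = 1 / 16 := by
    rw [towerDist]
    norm_num [Real.rpow_neg]
  refine h0.trans fun x hx => ?_
  rw [towerHull, towerLeft, hd] at hx
  exact ⟨by linarith [hx.1], by linarith [hx.2]⟩

/-- The towers of generation `n + 1` contribute a multiple of `1 / (n + 1)` to the integral of the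
`p`th power. -/
theorem not_memLp_towerFun {p : ℝ} (hp : 1 < p) {a b : ℝ} (hab : a < b) {Q : Set ℝ}
    (hQ : Ioo a b ⊆ Q) :
    ¬ MemLp (towerFun p a b) (ENNReal.ofReal p) (volume.restrict Q) := by
  intro hmem
  have hp0 : 0 < p := by linarith
  have hs0 : 0 < b - a := sub_pos.2 hab
  set φ : ℝ → ℝ := fun x => (x - a) / (b - a) with hφ
  have hφm : Measurable φ := (measurable_id.sub_const a).div_const _
  have hlt := lintegral_rpow_enorm_lt_top_of_eLpNorm_lt_top (by simpa using hp0)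
    ENNReal.ofReal_ne_top hmem.2
  rw [ENNReal.toReal_ofReal hp0.le] at hlt
  set S : (Σ n : ℕ, Fin (2 ^ n)) → Set ℝ := fun q => φ ⁻¹' towerBase (q.1 + 1) q.2 with hS
  have hSm : ∀ q, MeasurableSet (S q) := fun q => hφm (measurableSet_towerBase _ _)
  have hSQ : ⋃ q, S q ⊆ Q := by
    refine iUnion_subset fun q x hx => hQ ?_
    have h1 := towerBase_subset_Ioo q.2.2 hx
    simp only [hφ, mem_Ioo, div_pos_iff_of_pos_right hs0, div_lt_one hs0] at h1
    exact ⟨by linarith, by linarith⟩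
  have hdisj : Pairwise (Function.onFun Disjoint S) := by
    rintro ⟨n, k⟩ ⟨m, l⟩ hne
    refine disjoint_left.2 fun x hx hx' => hne ?_
    obtain ⟨h1, h2⟩ := towerBase_disjoint k.2 l.2 hx hx'
    subst h1
    congr
    exact Fin.ext h2
  have hvol : ∀ n k, volume (φ ⁻¹' towerBase n k) =
      ENNReal.ofReal (b - a) * ENNReal.ofReal (towerWidth n) := by
    intro n k
    have h1 : φ ⁻¹' towerBase n k = Icc (a + (b - a) * towerLeft n k)
        (a + (b - a) * (towerLeft n k + towerWidth n)) := by
      ext x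
      simp only [hφ, towerBase, mem_preimage, mem_Icc, le_div_iff₀ hs0, div_le_iff₀ hs0]
      constructor <;> rintro ⟨h1, h2⟩ <;> constructor <;> linarith
    rw [h1, Real.volume_Icc, ← ENNReal.ofReal_mul hs0.le]
    congr 1
    ring
  have hge : ∑' q, ∫⁻ x in S q, ‖towerFun p a b x‖ₑ ^ p ≤
      ∫⁻ x in Q, ‖towerFun p a b x‖ₑ ^ p := by
    rw [← lintegral_iUnion hSm hdisj]
    exact lintegral_mono_set hSQ
  have hterm : ∀ q, ∫⁻ x in S q, ‖towerFun p a b x‖ₑ ^ p = ENNReal.ofReal (b - a) *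
      ENNReal.ofReal (towerHeight p (q.1 + 1) ^ p * towerWidth (q.1 + 1)) := by
    intro q
    have h1 : ∀ x ∈ S q, ‖towerFun p a b x‖ₑ ^ p =
        ENNReal.ofReal (towerHeight p (q.1 + 1) ^ p) := fun x hx => by
      rw [towerFun, unitTowerFun_of_mem q.2.2 hx, Real.enorm_eq_ofReal (towerHeight_nonneg _ _),
        ENNReal.ofReal_rpow_of_nonneg (towerHeight_nonneg _ _) hp0.le]
    rw [setLIntegral_congr_fun (hSm q) h1, setLIntegral_const, hvol,
      ENNReal.ofReal_mul (Real.rpow_nonneg (towerHeight_nonneg _ _) _)]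
    ring
  simp_rw [hterm, ENNReal.tsum_sigma'] at hge
  simp only [tsum_fintype, Finset.sum_const, Finset.card_univ, Fintype.card_fin] at hge
  have hsum : ∀ n : ℕ, 2 ^ n • (ENNReal.ofReal (b - a) *
      ENNReal.ofReal (towerHeight p (n + 1) ^ p * towerWidth (n + 1))) =
      ENNReal.ofReal ((b - a) * (2 : ℝ) ^ (-(5 / 4) : ℝ) * (1 / (n + 1))) := by
    intro n
    have h2 : (2 : ENNReal) ^ n = ENNReal.ofReal (2 ^ n) := by simp [ENNReal.ofReal_pow]
    have h3 := towerHeight_rpow_mul_towerWidth hp0 n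
    rw [nsmul_eq_mul, Nat.cast_pow, Nat.cast_ofNat, mul_left_comm, h2,
      ← ENNReal.ofReal_mul (by positivity), h3, ← ENNReal.ofReal_mul hs0.le]
    congr 1
    ring
  simp_rw [hsum] at hge
  have hfin := ne_top_of_le_ne_top hlt.ne hge
  have hsumm : Summable fun n : ℕ =>
      (b - a) * (2 : ℝ) ^ (-(5 / 4) : ℝ) * (1 / ((n : ℝ) + 1)) := by
    refine (ENNReal.summable_toReal hfin).congr fun n => ?_
    exact ENNReal.toReal_ofReal (by positivity)
  rw [summable_mul_left_iff (by positivity)] at hsumm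
  refine Real.not_summable_one_div_natCast ((summable_nat_add_iff 1).1 ?_)
  simpa using hsumm

end JohnNirenberg

theorem proposition4p4 (p : ℝ) (hp : 1 < p) (a b : ℝ) (hab : a < b)
    (Q₀ : Set ℝ) (hQ₁ : Set.Ioo a b ⊆ Q₀) (hQ₂ : Q₀ ⊆ Set.Icc a b) :
    JohnNirenberg.MemVJN p Q₀ (JohnNirenberg.towerFun p a b) ∧
    ¬ MeasureTheory.MemLp (JohnNirenberg.towerFun p a b) (ENNReal.ofReal p)
        (MeasureTheory.volume.restrict Q₀) ∧
    {f : ℝ → ℝ | MeasureTheory.MemLp f (ENNReal.ofReal p)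
        (MeasureTheory.volume.restrict Q₀)} ⊂
      {f : ℝ → ℝ | JohnNirenberg.MemVJN p Q₀ f} := by
  have hQ : volume Q₀ ≠ ⊤ := ne_top_of_le_ne_top (by simp) (measure_mono hQ₂)
  have hV := JohnNirenberg.memVJN_towerFun hp hab hQ
  have hL := JohnNirenberg.not_memLp_towerFun hp hab hQ₁
  exact ⟨hV, hL, fun f hf => JohnNirenberg.memVJN_of_memLp hp hQ hf, fun hsub => hL (hsub hV)⟩
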